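/- \textbf{Setting.} Let $\mathcal D\subset\mathbb R^2$ be open, $T>0$, and let $\mathbf y$ be a random vector in $\mathbb R^N$ with law $\mu$; $\mathbb E$ and all spaces $L^p(\mathbb R^N;\cdot)$ refer to $\mu$, $(\cdot,\cdot)_{\mathcal D}$ is the $L^2(\mathcal D)$ inner product (for $u_{tt}$ below, the $H^{-1}$--$H^1_0$ pairing), and $\nabla$, $\mathrm{div}$ act in the space variable $\mathbf x\in\mathcal D$. For $0<a_{\min}\le a_{\max}$, a coefficient with bounds $a_{\min},a_{\max}$ is a measurable real function $a(\mathbf x,\mathbf y)$, weakly differentiable in $\mathbf x$, such that $a^2\in L^\infty(\mathbb R^N;W^{1,\infty}(\mathcal D))$, $a^2\ge a_{\min}$ a.e. in $\mathcal D\times\mathbb R^N$ and $\|a^2\|_{L^\infty(\mathbb R^N;W^{1,\infty}(\mathcal D))}\le a_{\max}$, where the norm is $\max(\operatorname{ess\,sup}|b|,\operatorname{ess\,sup}|\nabla b|)$. A weak solution for $a$ is a pair $(u,\mathbf q)$ with $u\in L^2(\mathbb R^N;H^2(0,T;H^{-1}(\mathcal D)))\cap L^2(\mathbb R^N;L^2(0,T;H^1_0(\mathcal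 D)))$, $u_t\in L^2(\mathbb R^N;L^2(0,T;L^2(\mathcal D)))$, $\mathbf q\in L^2(\mathbb R^N;L^2(0,T;H^1(\mathcal D)))^2$ and $\mathbf q_t\in L^2(\mathbb R^N;L^2(0,T;L^2(\mathcal D)))^2$, such that for a.e. $t\in(0,T)$ \begin{align*} \mathbb E[(u_{tt},p)_{\mathcal D}]+\mathbb E[(a\mathbf q,\nabla p)_{\mathcal D}]&=0 &&\forall p\in L^2(\mathbb R^N;H^1_0(\mathcal D)),\\ \mathbb E[(\mathbf q_t,\mathbf w)_{\mathcal D}]+\mathbb E[(a u_t,\mathrm{div}\,\mathbf w)_{\mathcal D}]+\mathbb E[(u_t\nabla a,\mathbf w)_{\mathcal D}]&=0 &&\forall \mathbf w\in L^2(\mathbb R^N;H^1(\mathcal D))^2 . \end{align*} (This is the weak form of $u_{tt}=\mathrm{div}(a\mathbf q)$, $\mathbf q_t=a\nabla u_t$, $u|_{\partial\mathcal D}=0$.) Here $u$, $u_t$, $\mathbf q$ denote the representatives that are continuous in time, in $L^2(\mathbb R^N;L^2(\mathcal D))$ for $u,\mathbf q$ and in $L^2(\mathbb R^N;H^{-1}(\mathcal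 D))$ for $u_t$, the values $u_t(t)$, $t\in[0,T]$, lying in $L^2(\mathbb R^N;L^2(\mathcal D))$. \textbf{Theorem} (stability with respect to the random wave speed). For all $0<a_{\min}\le a_{\max}$ and $0<\tilde a_{\min}\le\tilde a_{\max}$ there is a constant $K>0$, depending only on these four numbers, such that the following holds for all $N$, $\mu$, $\mathcal D$, $T$ as above, for every coefficient $a$ with bounds $a_{\min},a_{\max}$ and every weak solution $(u,\mathbf q)$ for $a$. (i) For a.e. $t\in(0,T)$ the functions $\nabla u_t(t)$ and $\mathrm{div}\,\mathbf q(t)$ are in $L^2(\mathbb R^N;L^2(\mathcal D))$, and there is a finite $M$ with $$\bigl(\mathbb E[\|u_t\|_{L^2(\mathcal D)}^2+\|\nabla u_t\|_{L^2(\mathcal D)}^2+\|\mathbf q\|_{L^2(\mathcal D)}^2+\|\mathrm{div}\,\mathbf q\|_{L^2(\mathcal D)}^2]\bigr)^{1/2}\le M\qquad\text{for a.e. }t\in(0,T).$$ (ii) For every such $M$, every $C_0\in\mathbb R$ and $\epsilon>0$, every coefficient $\tilde a$ with bounds $\tilde a_{\min},\tilde a_{\max}$ and every weak solution $(\tilde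 u,\tilde{\mathbf q})$ for $\tilde a$: if $a\tilde a>0$ a.e. (same sign), $\|a^2-\tilde a^2\|_{L^\infty(\mathbb R^N;W^{1,\infty}(\mathcal D))}\le\epsilon$ and $$\bigl(\mathbb E[\|u_t(0)-\tilde u_t(0)\|_{L^2(\mathcal D)}^2]+\mathbb E[\|\mathbf q(0)-\tilde{\mathbf q}(0)\|_{L^2(\mathcal D)}^2]\bigr)^{1/2}\le C_0\epsilon,$$ then for all $t\in[0,T]$ $$\bigl(\mathbb E[\|(u-\tilde u)_t(t)\|_{L^2(\mathcal D)}^2]\bigr)^{1/2}+\bigl(\mathbb E[\|\mathbf q(t)-\tilde{\mathbf q}(t)\|_{L^2(\mathcal D)}^2]\bigr)^{1/2}\le C(t+1)\epsilon,\qquad C=K\,(C_0+M).$$ -/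

import Mathlib

open MeasureTheory Set Filter Topology
open scoped ENNReal ContDiff

noncomputable section

namespace RandomWave

/-- The Euclidean plane, which contains the spatial domain. -/
abbrev Plane : Type := EuclideanSpace ℝ (Fin 2)

/-- The values of the random vector `y = (y₁, …, y_N)`. -/
abbrev Param (N : ℕ) : Type := Fin N → ℝ

/-- Test functions: smooth, with compact support contained in `D`. -/
def IsTest (D : Set Plane) (φ : Plane → ℝ) : Prop :=
  ContDiff ℝ ∞ φ ∧ HasCompactSupport φ ∧ tsupport φ ⊆ D

/-- `g` is the weak (distributional) gradient of `f` on the open set `D`. -/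
def HasWeakGrad (D : Set Plane) (f : Plane → ℝ) (g : Plane → Plane) : Prop :=
  LocallyIntegrableOn f D volume ∧ LocallyIntegrableOn g D volume ∧
    ∀ φ : Plane → ℝ, IsTest D φ →
      ∫ x in D, f x • gradient φ x = - ∫ x in D, φ x • g x

/-- `f` belongs to `H¹₀(D)`, the closure of the test functions in `H¹(D)`, and `g` is its
gradient. -/
def IsH10 (D : Set Plane) (f : Plane → ℝ) (g : Plane → Plane) : Prop :=
  MemLp f 2 (volume.restrict D) ∧ MemLp g 2 (volume.restrict D) ∧
    ∃ φ : ℕ → Plane → ℝ, (∀ n, IsTest D (φ n)) ∧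
      Tendsto (fun n => eLpNorm (fun x => φ n x - f x) 2 (volume.restrict D)) atTop (𝓝 0) ∧
      Tendsto (fun n => eLpNorm (fun x => gradient (φ n) x - g x) 2 (volume.restrict D))
        atTop (𝓝 0)

/-- The law `μ` of `y` times Lebesgue measure on `D`. -/
abbrev prodMeasure {N : ℕ} (μ : Measure (Param N)) (D : Set Plane) :
    Measure (Param N × Plane) :=
  μ.prod (volume.restrict D)

/-- `L²(ℝ^N; L²(D))`, with `ℝ^N` carrying the law `μ`. -/
abbrev ScalarL2 {N : ℕ} (μ : Measure (Param N)) (D : Set Plane) : Type :=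
  Lp ℝ 2 (prodMeasure μ D)

/-- `L²(ℝ^N; L²(D)²)`. -/
abbrev VectorL2 {N : ℕ} (μ : Measure (Param N)) (D : Set Plane) : Type :=
  Lp Plane 2 (prodMeasure μ D)

/-- `g` is the weak gradient of `f` with respect to the spatial variable, for almost every value
of the random vector. With `f`, `g` square integrable this says `f ∈ L²(ℝ^N; H¹(D))`, `∇f = g`. -/
def HasSpatialGrad {N : ℕ} {μ : Measure (Param N)} {D : Set Plane}
    (f : ScalarL2 μ D) (g : VectorL2 μ D) : Prop :=
  ∀ᵐ y ∂μ, HasWeakGrad D (fun x => f (y, x)) (fun x => g (y, x))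

/-- `w ∈ (L²(ℝ^N; H¹(D)))²`, where `G i` is the spatial gradient of the component `w i`. -/
def HasSpatialJacobian {N : ℕ} {μ : Measure (Param N)} {D : Set Plane}
    (w : VectorL2 μ D) (G : Fin 2 → VectorL2 μ D) : Prop :=
  ∀ i, ∀ᵐ y ∂μ, HasWeakGrad D (fun x => w (y, x) i) (fun x => G i (y, x))

/-- The divergence of a vector field whose components have the gradients `G i`. -/
def divergence {N : ℕ} {μ : Measure (Param N)} {D : Set Plane}
    (G : Fin 2 → VectorL2 μ D) (z : Param N × Plane) : ℝ :=
  ∑ i, G i z i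

theorem IsTest.aestronglyMeasurable {D : Set Plane} {φ : Plane → ℝ} (h : IsTest D φ) :
    AEStronglyMeasurable φ (volume.restrict D) ∧
      AEStronglyMeasurable (gradient φ) (volume.restrict D) := by
  refine ⟨h.1.continuous.aestronglyMeasurable, ?_⟩
  have h1 : Continuous (fderiv ℝ φ) := h.1.continuous_fderiv (by simp)
  have h2 : Continuous (gradient φ) := by
    unfold gradient
    exact (InnerProductSpace.toDual ℝ Plane).symm.continuous.comp h1
  exact h2.aestronglyMeasurable

theorem gradient_add_fun {φ ψ : Plane → ℝ} (hφ : ContDiff ℝ ∞ φ) (hψ : ContDiff ℝ ∞ ψ)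
    (x : Plane) : gradient (fun z => φ z + ψ z) x = gradient φ x + gradient ψ x := by
  have h1 : DifferentiableAt ℝ φ x := (hφ.differentiable (by simp)) x
  have h2 : DifferentiableAt ℝ ψ x := (hψ.differentiable (by simp)) x
  unfold gradient
  rw [← map_add]
  congr 1
  exact fderiv_add h1 h2

theorem gradient_smul_fun {φ : Plane → ℝ} (hφ : ContDiff ℝ ∞ φ) (c : ℝ)
    (x : Plane) : gradient (fun z => c * φ z) x = c • gradient φ x := by
  have h1 : DifferentiableAt ℝ φ x := (hφ.differentiable (by simp)) x
  unfold gradient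
  have h2 : fderiv ℝ (fun z => c * φ z) x = c • fderiv ℝ φ x := fderiv_const_mul h1 c
  rw [h2]
  simp

theorem isH10_zero (D : Set Plane) : IsH10 D (fun _ => 0) (fun _ => 0) := by
  refine ⟨MemLp.zero, MemLp.zero, fun _ _ => 0, fun _ => ⟨contDiff_const, ?_, ?_⟩, ?_, ?_⟩
  · exact HasCompactSupport.zero
  · simp [tsupport]
  · simp
  · simp [gradient]

theorem IsH10.add {D : Set Plane} {f f' : Plane → ℝ} {g g' : Plane → Plane}
    (h : IsH10 D f g) (h' : IsH10 D f' g') :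
    IsH10 D (fun x => f x + f' x) (fun x => g x + g' x) := by
  obtain ⟨hf, hg, φ, hφ, l1, l2⟩ := h
  obtain ⟨hf', hg', ψ, hψ, l1', l2'⟩ := h'
  refine ⟨hf.add hf', hg.add hg', fun n x => φ n x + ψ n x, fun n => ⟨?_, ?_, ?_⟩, ?_, ?_⟩
  · exact (hφ n).1.add (hψ n).1
  · exact (hφ n).2.1.add (hψ n).2.1
  · exact (tsupport_add _ _).trans (union_subset (hφ n).2.2 (hψ n).2.2)
  · refine tendsto_of_tendsto_of_tendsto_of_le_of_le tendsto_const_nhds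
      (by simpa using l1.add l1') (fun _ => zero_le) (fun n => ?_)
    have e : (fun x => φ n x + ψ n x - (f x + f' x))
        = (fun x => φ n x - f x) + (fun x => ψ n x - f' x) := by
      funext x; simp only [Pi.add_apply]; ring
    simp only [e]
    exact eLpNorm_add_le ((hφ n).aestronglyMeasurable.1.sub hf.1) ((hψ n).aestronglyMeasurable.1.sub hf'.1) (by norm_num)
  · refine tendsto_of_tendsto_of_tendsto_of_le_of_le tendsto_const_nhds
      (by simpa using l2.add l2') (fun _ => zero_le) (fun n => ?_)
    have e : (fun x => gradient (fun z => φ n z + ψ n z) x - (g x + g' x))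
        = (fun x => gradient (φ n) x - g x) + (fun x => gradient (ψ n) x - g' x) := by
      funext x
      simp only [Pi.add_apply]
      rw [gradient_add_fun (hφ n).1 (hψ n).1]; abel
    simp only [e]
    exact eLpNorm_add_le ((hφ n).aestronglyMeasurable.2.sub hg.1) ((hψ n).aestronglyMeasurable.2.sub hg'.1) (by norm_num)

theorem IsH10.smul {D : Set Plane} {f : Plane → ℝ} {g : Plane → Plane} (c : ℝ)
    (h : IsH10 D f g) : IsH10 D (fun x => c * f x) (fun x => c • g x) := by
  obtain ⟨hf, hg, φ, hφ, l1, l2⟩ := h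
  have hc : ‖c‖ₑ ≠ ⊤ := enorm_ne_top
  refine ⟨hf.const_mul c, hg.const_smul c, fun n x => c * φ n x, fun n => ⟨?_, ?_, ?_⟩, ?_, ?_⟩
  · exact contDiff_const.mul (hφ n).1
  · exact (hφ n).2.1.mul_left
  · exact (tsupport_mul_subset_right).trans (hφ n).2.2
  · have e : ∀ n, (fun x => c * φ n x - c * f x) = c • (fun x => φ n x - f x) := by
      intro n; funext x; simp only [Pi.smul_apply, smul_eq_mul]; ring
    simp only [e, eLpNorm_const_smul]
    simpa using ENNReal.Tendsto.const_mul l1 (Or.inr hc)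
  · have e : ∀ n, (fun x => gradient (fun z => c * φ n z) x - c • g x)
        = c • (fun x => gradient (φ n) x - g x) := by
      intro n; funext x
      simp only [Pi.smul_apply]
      rw [gradient_smul_fun (hφ n).1, smul_sub]
    simp only [e, eLpNorm_const_smul]
    simpa using ENNReal.Tendsto.const_mul l2 (Or.inr hc)

theorem IsH10.congr {D : Set Plane} {f f' : Plane → ℝ} {g g' : Plane → Plane}
    (h : IsH10 D f g) (hf : f =ᵐ[volume.restrict D] f') (hg : g =ᵐ[volume.restrict D] g') :
    IsH10 D f' g' := by
  obtain ⟨mf, mg, φ, hφ, l1, l2⟩ := h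
  refine ⟨mf.ae_eq hf, mg.ae_eq hg, φ, hφ, ?_, ?_⟩
  · refine l1.congr (fun n => eLpNorm_congr_ae ?_)
    filter_upwards [hf] with x hx
    rw [hx]
  · refine l2.congr (fun n => eLpNorm_congr_ae ?_)
    filter_upwards [hg] with x hx
    rw [hx]

/-- The pairs `(p, ∇p)` with `p` and `∇p` square integrable and `p(·, y) ∈ H¹₀(D)` for almost
every `y`, as a subspace of a product of `L²` spaces. -/
def l2H10Submodule {N : ℕ} (μ : Measure (Param N)) (D : Set Plane) :
    Submodule ℝ (WithLp 2 (ScalarL2 μ D × VectorL2 μ D)) where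
  carrier := {p | ∀ᵐ y ∂μ, IsH10 D (fun x => p.fst (y, x)) (fun x => p.snd (y, x))}
  zero_mem' := by
    have h1 := Measure.ae_ae_of_ae_prod (Lp.coeFn_zero ℝ 2 (prodMeasure μ D))
    have h2 := Measure.ae_ae_of_ae_prod (Lp.coeFn_zero Plane 2 (prodMeasure μ D))
    rw [Set.mem_ofPred_eq]
    filter_upwards [h1, h2] with y h1 h2
    exact (isH10_zero D).congr (EventuallyEq.symm h1) (EventuallyEq.symm h2)
  add_mem' := by
    intro p q hp hq
    have h1 := Measure.ae_ae_of_ae_prod (Lp.coeFn_add p.fst q.fst)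
    have h2 := Measure.ae_ae_of_ae_prod (Lp.coeFn_add p.snd q.snd)
    rw [Set.mem_ofPred_eq] at hp hq ⊢
    filter_upwards [h1, h2, hp, hq] with y h1 h2 hp hq
    exact (hp.add hq).congr (EventuallyEq.symm h1) (EventuallyEq.symm h2)
  smul_mem' := by
    intro c p hp
    have h1 := Measure.ae_ae_of_ae_prod (Lp.coeFn_smul c p.fst)
    have h2 := Measure.ae_ae_of_ae_prod (Lp.coeFn_smul c p.snd)
    rw [Set.mem_ofPred_eq] at hp ⊢
    filter_upwards [h1, h2, hp] with y h1 h2 hp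
    exact (hp.smul c).congr (EventuallyEq.symm h1) (EventuallyEq.symm h2)

/-- `L²(ℝ^N; H¹₀(D))`, with the `H¹` norm. An element is a pair `(p, ∇p)`. -/
def L2H10 {N : ℕ} (μ : Measure (Param N)) (D : Set Plane) : Type :=
  ↥(l2H10Submodule μ D)

instance {N : ℕ} (μ : Measure (Param N)) (D : Set Plane) : NormedAddCommGroup (L2H10 μ D) :=
  inferInstanceAs (NormedAddCommGroup ↥(l2H10Submodule μ D))

instance {N : ℕ} (μ : Measure (Param N)) (D : Set Plane) : InnerProductSpace ℝ (L2H10 μ D) :=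
  inferInstanceAs (InnerProductSpace ℝ ↥(l2H10Submodule μ D))

/-- The function `p` of a pair `(p, ∇p)` in `L²(ℝ^N; H¹₀(D))`. -/
def L2H10.toL2 {N : ℕ} {μ : Measure (Param N)} {D : Set Plane} :
    L2H10 μ D →L[ℝ] ScalarL2 μ D :=
  (WithLp.fstL 2 ℝ (ScalarL2 μ D) (VectorL2 μ D)).comp (l2H10Submodule μ D).subtypeL

/-- The gradient `∇p` of a pair `(p, ∇p)` in `L²(ℝ^N; H¹₀(D))`. -/
def L2H10.grad {N : ℕ} {μ : Measure (Param N)} {D : Set Plane} :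
    L2H10 μ D →L[ℝ] VectorL2 μ D :=
  (WithLp.sndL 2 ℝ (ScalarL2 μ D) (VectorL2 μ D)).comp (l2H10Submodule μ D).subtypeL

/-- `L²(ℝ^N; H⁻¹(D))`, the dual space of `L²(ℝ^N; H¹₀(D))`. -/
abbrev L2Hneg {N : ℕ} (μ : Measure (Param N)) (D : Set Plane) : Type :=
  StrongDual ℝ (L2H10 μ D)

/-- The embedding of `L²(ℝ^N; L²(D))` into `L²(ℝ^N; H⁻¹(D))`, which sends `f` to
`p ↦ E[(f, p)_D]`. -/
def toL2Hneg {N : ℕ} {μ : Measure (Param N)} {D : Set Plane} (f : ScalarL2 μ D) :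
    L2Hneg μ D :=
  (innerSL ℝ f).comp L2H10.toL2

/-- `f ∈ W^{1,2}(0,T;X)` with weak derivative `f'`, where `f` stands for its continuous
representative: `f' ∈ L²(0,T;X)` and `f(t) = f(0) + ∫₀ᵗ f'(s) ds` for all `t ∈ [0,T]`. -/
def HasTimeDeriv {X : Type*} [NormedAddCommGroup X] [NormedSpace ℝ X] (T : ℝ)
    (f f' : ℝ → X) : Prop :=
  MemLp f' 2 (volume.restrict (Ioo 0 T)) ∧
    ∀ t ∈ Icc 0 T, f t = f 0 + ∫ s in (0 : ℝ)..t, f' s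

/-- `E[(f, g)_D]` for scalar `f`, `g`. -/
def expInner {N : ℕ} (μ : Measure (Param N)) (D : Set Plane)
    (f g : Param N × Plane → ℝ) : ℝ :=
  ∫ y, (∫ x in D, f (y, x) * g (y, x)) ∂μ

/-- `E[(f, g)_D]` for vector valued `f`, `g`. -/
def expInnerVec {N : ℕ} (μ : Measure (Param N)) (D : Set Plane)
    (f g : Param N × Plane → Plane) : ℝ :=
  ∫ y, (∫ x in D, inner ℝ (f (y, x)) (g (y, x))) ∂μ

/-- `E[‖f‖²_{L²(D)}]`. -/
def meanSq {N : ℕ} {E : Type*} [NormedAddCommGroup E] (μ : Measure (Param N)) (D : Set Plane)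
    (f : Param N × Plane → E) : ℝ :=
  ∫ y, (∫ x in D, ‖f (y, x)‖ ^ 2) ∂μ

/-- `b` belongs to `L^∞(ℝ^N; W^{1,∞}(D))` and its norm there (the larger one of the essential
suprema of `|b|` and of `|∇b|`) is at most `c`. -/
def LinftyW1inftyNormLE {N : ℕ} (μ : Measure (Param N)) (D : Set Plane)
    (b : Param N × Plane → ℝ) (c : ℝ) : Prop :=
  AEStronglyMeasurable b (prodMeasure μ D) ∧
    (∀ᵐ z ∂(prodMeasure μ D), |b z| ≤ c) ∧
    ∃ g : Param N × Plane → Plane, AEStronglyMeasurable g (prodMeasure μ D) ∧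
      (∀ᵐ y ∂μ, HasWeakGrad D (fun x => b (y, x)) (fun x => g (y, x))) ∧
      ∀ᵐ z ∂(prodMeasure μ D), ‖g z‖ ≤ c

/-- `a` is an admissible coefficient: it is measurable, `ga` is its weak spatial gradient,
`a² ≥ amin` almost everywhere and `‖a²‖ ≤ amax` in `L^∞(ℝ^N; W^{1,∞}(D))`. -/
structure IsCoefficient {N : ℕ} (μ : Measure (Param N)) (D : Set Plane) (amin amax : ℝ)
    (a : Param N × Plane → ℝ) (ga : Param N × Plane → Plane) : Prop where
  meas : AEStronglyMeasurable a (prodMeasure μ D)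
  meas_grad : AEStronglyMeasurable ga (prodMeasure μ D)
  grad : ∀ᵐ y ∂μ, HasWeakGrad D (fun x => a (y, x)) (fun x => ga (y, x))
  lower : ∀ᵐ z ∂(prodMeasure μ D), amin ≤ a z ^ 2
  upper : LinftyW1inftyNormLE μ D (fun z => a z ^ 2) amax

/-- `(u, q)`, with `ut` the time derivative of `u`, is a weak solution on `(0,T)` of
`u_tt = div(a q)`, `q_t = a ∇u_t`, `u = 0` on `∂D`. Here `ga = ∇a`. -/
structure IsWeakSolution {N : ℕ} (μ : Measure (Param N)) (D : Set Plane) (T : ℝ)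
    (a : Param N × Plane → ℝ) (ga : Param N × Plane → Plane)
    (u ut : ℝ → ScalarL2 μ D) (q : ℝ → VectorL2 μ D) : Prop where
  /-- `u_t` is the time derivative of `u`. -/
  deriv_u : HasTimeDeriv T u ut
  /-- `u ∈ L²(0,T; L²(ℝ^N; H¹₀(D)))`. -/
  mem_u : ∃ U : ℝ → L2H10 μ D, MemLp U 2 (volume.restrict (Ioo 0 T)) ∧
    ∀ᵐ t ∂(volume.restrict (Ioo 0 T)), L2H10.toL2 (U t) = u t
  /-- `q ∈ L²(0,T; (L²(ℝ^N; H¹(D)))²)`. -/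
  mem_q : MemLp q 2 (volume.restrict (Ioo 0 T)) ∧
    ∃ G : Fin 2 → ℝ → VectorL2 μ D, (∀ i, MemLp (G i) 2 (volume.restrict (Ioo 0 T))) ∧
      ∀ᵐ t ∂(volume.restrict (Ioo 0 T)), HasSpatialJacobian (q t) (fun i => G i t)
  /-- `u_tt ∈ L²(0,T; L²(ℝ^N; H⁻¹(D)))` and `E[(u_tt, p)_D] + E[(a q, ∇p)_D] = 0` for all
  `p ∈ L²(ℝ^N; H¹₀(D))`. -/
  eq_u : ∃ utt : ℝ → L2Hneg μ D, HasTimeDeriv T (fun t => toL2Hneg (ut t)) utt ∧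
    ∀ᵐ t ∂(volume.restrict (Ioo 0 T)), ∀ p : L2H10 μ D,
      utt t p + expInnerVec μ D (fun z => a z • q t z) (L2H10.grad p) = 0
  /-- `E[(q_t, w)_D] + E[(a u_t, div w)_D] + E[(∇a u_t, w)_D] = 0` for all
  `w ∈ (L²(ℝ^N; H¹(D)))²`. -/
  eq_q : ∃ qt : ℝ → VectorL2 μ D, HasTimeDeriv T q qt ∧
    ∀ᵐ t ∂(volume.restrict (Ioo 0 T)), ∀ (w : VectorL2 μ D) (G : Fin 2 → VectorL2 μ D),
      HasSpatialJacobian w G →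
      expInnerVec μ D (qt t) w + expInner μ D (fun z => a z * ut t z) (divergence G)
        + expInnerVec μ D (fun z => ut t z • ga z) w = 0

/-- For almost every `t ∈ (0,T)`, the functions `∇u_t` and `div q` are square integrable and
`(E[‖u_t‖² + ‖∇u_t‖² + ‖q‖² + ‖div q‖²])^{1/2} ≤ M`, with norms in `L²(D)`. -/
def SolutionNormLE {N : ℕ} (μ : Measure (Param N)) (D : Set Plane) (T : ℝ)
    (ut : ℝ → ScalarL2 μ D) (q : ℝ → VectorL2 μ D) (M : ℝ) : Prop :=
  ∀ᵐ t ∂(volume.restrict (Ioo 0 T)),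
    ∃ (gut : VectorL2 μ D) (G : Fin 2 → VectorL2 μ D),
      HasSpatialGrad (ut t) gut ∧ HasSpatialJacobian (q t) G ∧
      √(meanSq μ D (ut t) + meanSq μ D gut + meanSq μ D (q t) + meanSq μ D (divergence G)) ≤ M

end RandomWave

end

/-!
The proof is an energy estimate for the difference `e = u_t - ũ_t`, `r = q - q̃` of two solutions,
regarded as a solution of the system with coefficient `ã` with a small right hand side.

*Weak solutions are strong.* A coefficient `a` is bounded, bounded away from zero, and has a bounded
gradient because `2 a ∇a = ∇(a²)` (`HasWeakGrad.sq`, `IsCoefficient.norm_grad_le`). So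
multiplication by `a` and by `1 / a` preserves `H¹`, with the product rule
(`HasWeakGrad.mul`, `HasWeakGrad.inv`, `IsMultiplier.exists_mul`); these facts are proved by mollification. Hence `u_tt` is the square
integrable function `div (a q)`, and the equation for `q_t` reads `(q_t, w) + (u_t, div (a w)) = 0`
for all `w` in `H¹` (`IsWeakSolution.exists_strong`). Inserting `w / a` for `w` shows that
`u_t` has the gradient `q_t / a` (`inner_div_add_integral`). No boundary condition is imposed on
`w`, so this identity also carries the boundary condition for `u_t`, and no boundary terms arise.

*Existence of `M`.* With `w = q(s)` the equation at time `t` says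
`(q_t(t), q(s)) + (u_t(t), u_tt(s)) = 0`. Therefore the increments of `(u_t, q)` over a
fixed time step have constant norm, and `‖u_tt‖² + ‖q_t‖²` is constant in time (`HasTimeDeriv.exists_bound_deriv`). The equations turn this
into a bound for `∇u_t = q_t / a` and for `div q = (u_tt - ∇a · q) / a`
(`IsStrongSolution.exists_solutionNormLE`).

*Stability.* Let `c ε` bound `a - ã` and its gradient; such a `c` exists because the coefficients
have the same sign (`IsCoefficient.norm_sub_le`). The spatial operator with coefficient `ã` is skew
symmetric, so only the residuals contribute to the rate of change of the energy:
`(e, e_t) + (r, r_t) = (e, (a - ã) div q + ∇(a - ã) · q) + (r, (a - ã) ∇u_t)`, which is at most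
`3 c ε M (‖e‖² + ‖r‖²)^{1/2}` (`IsStrongSolution.inner_sub_le`). Integration in time gives linear
growth of `(‖e‖² + ‖r‖²)^{1/2}` (`HasTimeDeriv.sqrt_energy_le`).
-/

noncomputable section

namespace RandomWave

/-! ### Gradients of smooth functions and integrals over compact sets -/

theorem continuous_gradient {φ : Plane → ℝ} (hφ : ContDiff ℝ ∞ φ) : Continuous (gradient φ) := by
  unfold gradient
  exact (InnerProductSpace.toDual ℝ Plane).symm.continuous.comp (hφ.continuous_fderiv (by simp))

theorem gradient_mul_fun {φ ψ : Plane → ℝ} (hφ : ContDiff ℝ ∞ φ) (hψ : ContDiff ℝ ∞ ψ)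
    (x : Plane) :
    gradient (fun z => φ z * ψ z) x = φ x • gradient ψ x + ψ x • gradient φ x := by
  have h1 : DifferentiableAt ℝ φ x := (hφ.differentiable (by simp)) x
  have h2 : DifferentiableAt ℝ ψ x := (hψ.differentiable (by simp)) x
  unfold gradient
  rw [fderiv_fun_mul h1 h2]
  simp

theorem gradient_inv_fun {φ : Plane → ℝ} (hφ : ContDiff ℝ ∞ φ) (h0 : ∀ z, φ z ≠ 0) (x : Plane) :
    gradient (fun z => (φ z)⁻¹) x = -((φ x ^ 2)⁻¹ • gradient φ x) := by
  have h1 : HasFDerivAt φ (fderiv ℝ φ x) x := ((hφ.differentiable (by simp)) x).hasFDerivAt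
  have h2 := ((hasDerivAt_inv (h0 x)).comp_hasFDerivAt x h1).fderiv
  unfold gradient
  have h3 : fderiv ℝ (fun z => (φ z)⁻¹) x = -(φ x ^ 2)⁻¹ • fderiv ℝ φ x := h2
  rw [h3]
  simp

theorem gradient_eq_zero_of_notMem_tsupport {φ : Plane → ℝ} {x : Plane} (hx : x ∉ tsupport φ) :
    gradient φ x = 0 := by
  unfold gradient
  have : fderiv ℝ φ x = 0 := by
    by_contra h
    exact hx (support_fderiv_subset ℝ h)
  rw [this, map_zero]

theorem gradient_reflect {η : Plane → ℝ} (hη : ContDiff ℝ ∞ η) (x t : Plane) :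
    gradient (fun z => η (x - z)) t = - gradient η (x - t) := by
  have h1 : HasFDerivAt η (fderiv ℝ η (x - t)) (x - t) :=
    ((hη.differentiable (by simp)) _).hasFDerivAt
  have h2 : HasFDerivAt (fun z : Plane => x - z) (-ContinuousLinearMap.id ℝ Plane) t :=
    (hasFDerivAt_id t).const_sub x
  have h3 := (h1.comp t h2).fderiv
  have h4 : fderiv ℝ (fun z => η (x - z)) t = - fderiv ℝ η (x - t) := by
    have h5 : fderiv ℝ (fun z => η (x - z)) t
        = (fderiv ℝ η (x - t)).comp (-ContinuousLinearMap.id ℝ Plane) := h3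
    rw [h5]; ext v; simp
  unfold gradient
  rw [h4, map_neg]

section Compact

variable {E F : Type*} [NormedAddCommGroup E] [NormedAddCommGroup F]

/-- A function that vanishes off a compact subset of `D` and is dominated there by a locally
integrable function is integrable. -/
theorem integrable_of_le_on_compact {D K : Set Plane} {f : Plane → E} {h : Plane → F}
    {C : ℝ} (hf : LocallyIntegrableOn f D volume) (hK : IsCompact K) (hKD : K ⊆ D)
    (hm : AEStronglyMeasurable h (volume.restrict D))
    (hle : ∀ᵐ x ∂(volume.restrict D), x ∈ K → ‖h x‖ ≤ C * ‖f x‖)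
    (h0 : ∀ x, x ∉ K → h x = 0) :
    Integrable h (volume.restrict D) := by
  have h1 : IntegrableOn f K volume := hf.integrableOn_compact_subset hKD hK
  have h2 : Integrable (K.indicator fun x => C * ‖f x‖) (volume.restrict D) := by
    rw [integrable_indicator_iff hK.measurableSet]
    have h3 : IntegrableOn (fun x => C * ‖f x‖) K volume := h1.norm.const_mul C
    exact h3.mono_measure Measure.restrict_le_self
  refine h2.mono' hm ?_
  filter_upwards [hle] with x hx
  by_cases hxK : x ∈ K
  · simpa [hxK] using hx hxK
  · simp [h0 x hxK, hxK]

/-- Dominated convergence for functions that vanish off a compact subset of `D`. -/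
theorem tendsto_integral_of_le_on_compact [NormedSpace ℝ F] {D K : Set Plane} {f : Plane → E}
    {s : ℕ → Plane → F} {h : Plane → F} {C : ℝ} (hf : LocallyIntegrableOn f D volume)
    (hK : IsCompact K) (hKD : K ⊆ D)
    (hm : ∀ n, AEStronglyMeasurable (s n) (volume.restrict D))
    (hle : ∀ n, ∀ᵐ x ∂(volume.restrict D), x ∈ K → ‖s n x‖ ≤ C * ‖f x‖)
    (h0 : ∀ n x, x ∉ K → s n x = 0) (hh0 : ∀ x, x ∉ K → h x = 0)
    (hl : ∀ᵐ x ∂(volume.restrict D), x ∈ K → Tendsto (fun n => s n x) atTop (𝓝 (h x))) :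
    Tendsto (fun n => ∫ x in D, s n x) atTop (𝓝 (∫ x in D, h x)) := by
  have h1 : IntegrableOn f K volume := hf.integrableOn_compact_subset hKD hK
  have h2 : Integrable (K.indicator fun x => C * ‖f x‖) (volume.restrict D) := by
    rw [integrable_indicator_iff hK.measurableSet]
    have h3 : IntegrableOn (fun x => C * ‖f x‖) K volume := h1.norm.const_mul C
    exact h3.mono_measure Measure.restrict_le_self
  refine tendsto_integral_of_dominated_convergence _ hm h2 (fun n => ?_) ?_
  · filter_upwards [hle n] with x hx
    by_cases hxK : x ∈ K
    · simpa [hxK] using hx hxK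
    · simp [h0 n x hxK, hxK]
  · filter_upwards [hl] with x hx
    by_cases hxK : x ∈ K
    · exact hx hxK
    · simp [h0 _ x hxK, hh0 x hxK]

theorem locallyIntegrableOn_of_le {D : Set Plane} (hD : IsOpen D) {f : Plane → E} {h : Plane → F}
    {C : ℝ} (hf : LocallyIntegrableOn f D volume)
    (hm : AEStronglyMeasurable h (volume.restrict D))
    (hle : ∀ᵐ x ∂(volume.restrict D), ‖h x‖ ≤ C * ‖f x‖) : LocallyIntegrableOn h D volume := by
  rw [locallyIntegrableOn_iff hD.isLocallyClosed] at hf ⊢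
  intro k hkD hk
  have hmono : volume.restrict k ≤ (volume : Measure Plane).restrict D :=
    Measure.restrict_mono hkD le_rfl
  have h1 : IntegrableOn (fun x => C * ‖f x‖) k volume := (hf k hkD hk).norm.const_mul C
  exact h1.mono' (hm.mono_measure hmono) (ae_mono hmono hle)

theorem locallyIntegrableOn_of_bound {D : Set Plane} (hD : IsOpen D) {h : Plane → F} {C : ℝ}
    (hm : AEStronglyMeasurable h (volume.restrict D))
    (hle : ∀ᵐ x ∂(volume.restrict D), ‖h x‖ ≤ C) : LocallyIntegrableOn h D volume := by
  refine locallyIntegrableOn_of_le hD (f := fun _ => (1 : ℝ)) (C := C)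
    ((locallyIntegrable_const (1 : ℝ)).locallyIntegrableOn D) hm ?_
  simpa using hle

/-- The extension by zero of a function that is bounded on `D`. -/
theorem locallyIntegrable_indicator_of_bound {D : Set Plane} (hD : IsOpen D) {h : Plane → F}
    {C : ℝ} (hm : AEStronglyMeasurable h (volume.restrict D))
    (hle : ∀ᵐ x ∂(volume.restrict D), ‖h x‖ ≤ C) : LocallyIntegrable (D.indicator h) volume := by
  rw [← locallyIntegrableOn_univ]
  refine locallyIntegrableOn_of_bound isOpen_univ (C := max C 0) ?_ ?_
  · rw [Measure.restrict_univ]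
    exact (aestronglyMeasurable_indicator_iff hD.measurableSet).2 hm
  · rw [Measure.restrict_univ]
    filter_upwards [(ae_restrict_iff' hD.measurableSet).1 hle] with x hx
    by_cases hxD : x ∈ D
    · simp [hxD, hx hxD]
    · simp [hxD]

end Compact

/-! ### Mollification -/

/-- A bump function supported in the closed ball of radius `δ / (n + 2)`, which is at most `δ` and
tends to zero. Its inner radius is half of that, so that the mollifications converge almost
everywhere. -/
def bump (δ : ℝ) (hδ : 0 < δ) (n : ℕ) : ContDiffBump (0 : Plane) where
  rIn := δ / (n + 2) / 2
  rOut := δ / (n + 2)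
  rIn_pos := by positivity
  rIn_lt_rOut := half_lt_self (by positivity)

theorem bump_rOut_le {δ : ℝ} (hδ : 0 < δ) (n : ℕ) : (bump δ hδ n).rOut ≤ δ := by
  change δ / (n + 2) ≤ δ
  rw [div_le_iff₀ (by positivity)]
  nlinarith [(Nat.cast_nonneg n : (0 : ℝ) ≤ n)]

theorem tendsto_bump_rOut {δ : ℝ} (hδ : 0 < δ) :
    Tendsto (fun n => (bump δ hδ n).rOut) atTop (𝓝 0) := by
  change Tendsto (fun n : ℕ => δ / ((n : ℝ) + 2)) atTop (𝓝 0)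
  exact tendsto_const_nhds.div_atTop
    (tendsto_atTop_add_const_right _ _ tendsto_natCast_atTop_atTop)

section Mollify

variable {E : Type*} [NormedAddCommGroup E] [NormedSpace ℝ E]

/-- The convolution of `f` with the normalized bump function `η`. -/
def mollify (η : ContDiffBump (0 : Plane)) (f : Plane → E) (x : Plane) : E :=
  ∫ t, η.normed volume (x - t) • f t

open scoped Convolution in
theorem mollify_eq_convolution (η : ContDiffBump (0 : Plane)) (f : Plane → E) :
    mollify η f = (η.normed volume ⋆[ContinuousLinearMap.lsmul ℝ ℝ, volume] f) := by
  funext x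
  rw [convolution_lsmul_swap]
  rfl

theorem contDiff_mollify (η : ContDiffBump (0 : Plane)) {f : Plane → E}
    (hf : LocallyIntegrable f volume) : ContDiff ℝ ∞ (mollify η f) := by
  rw [mollify_eq_convolution]
  exact HasCompactSupport.contDiff_convolution_left _ η.hasCompactSupport_normed
    η.contDiff_normed hf

theorem integrable_bump_sub (η : ContDiffBump (0 : Plane)) (x : Plane) :
    Integrable (fun t => η.normed volume (x - t)) volume :=
  (η.integrable_normed (μ := (volume : Measure Plane))).comp_sub_left x

theorem integral_bump_sub (η : ContDiffBump (0 : Plane)) (x : Plane) :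
    ∫ t, η.normed volume (x - t) = 1 := by
  rw [integral_sub_left_eq_self (fun t => η.normed volume t) volume x, η.integral_normed]

theorem norm_mollify_le (η : ContDiffBump (0 : Plane)) {f : Plane → E} {C : ℝ}
    (hf : ∀ᵐ t, ‖f t‖ ≤ C) (x : Plane) : ‖mollify η f x‖ ≤ C := by
  have h1 : ‖mollify η f x‖ ≤ ∫ t, η.normed volume (x - t) * C := by
    refine norm_integral_le_of_norm_le ((integrable_bump_sub η x).mul_const C) ?_
    filter_upwards [hf] with t ht
    rw [norm_smul, Real.norm_of_nonneg (η.nonneg_normed _)]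
    exact mul_le_mul_of_nonneg_left ht (η.nonneg_normed _)
  rwa [integral_mul_const, integral_bump_sub, one_mul] at h1

theorem mollify_nonneg (η : ContDiffBump (0 : Plane)) {f : Plane → ℝ}
    (hf : ∀ᵐ t, 0 ≤ f t) (x : Plane) : 0 ≤ mollify η f x :=
  integral_nonneg_of_ae (hf.mono fun _ ht => mul_nonneg (η.nonneg_normed _) ht)

theorem ae_tendsto_mollify [CompleteSpace E] {δ : ℝ} (hδ : 0 < δ) {f : Plane → E}
    (hf : LocallyIntegrable f volume) :
    ∀ᵐ x, Tendsto (fun n => mollify (bump δ hδ n) f x) atTop (𝓝 (f x)) := by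
  simp only [mollify_eq_convolution]
  refine ContDiffBump.ae_convolution_tendsto_right_of_locallyIntegrable (K := 2)
    (tendsto_bump_rOut hδ) (Eventually.of_forall fun n => ?_) hf
  change δ / (n + 2) ≤ 2 * (δ / (n + 2) / 2)
  linarith

end Mollify

theorem gradient_mollify_eq_integral (η : ContDiffBump (0 : Plane)) {f : Plane → ℝ}
    (hf : LocallyIntegrable f volume) (x : Plane) :
    gradient (mollify η f) x = ∫ t, f t • gradient (η.normed volume) (x - t) := by
  have hc := η.hasCompactSupport_normed (μ := (volume : Measure Plane))
  have hs := η.contDiff_normed (n := 1) (μ := (volume : Measure Plane))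
  have h1 := HasCompactSupport.hasFDerivAt_convolution_left (ContinuousLinearMap.lsmul ℝ ℝ)
    (μ := volume) hc hs hf x
  rw [← mollify_eq_convolution] at h1
  have hint := ((hc.fderiv ℝ).convolutionExists_left
    ((ContinuousLinearMap.lsmul ℝ ℝ : ℝ →L[ℝ] ℝ →L[ℝ] ℝ).precompL Plane)
    (hs.continuous_fderiv one_ne_zero) hf x).integrable_swap
  let Φ : StrongDual ℝ Plane →L[ℝ] Plane :=
    { toFun := (InnerProductSpace.toDual ℝ Plane).symm
      map_add' := map_add _
      map_smul' := by intro c ℓ; simp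
      cont := (InnerProductSpace.toDual ℝ Plane).symm.continuous }
  change Φ (fderiv ℝ (mollify η f) x) = ∫ t, f t • Φ (fderiv ℝ (η.normed volume) (x - t))
  rw [h1.fderiv, convolution_eq_swap, ← Φ.integral_comp_comm hint]
  refine integral_congr_ae (Eventually.of_forall fun t => ?_)
  dsimp only
  rw [← map_smul]
  congr 1
  ext v
  simp [ContinuousLinearMap.precompL_apply, mul_comm]

/-- A mollified weakly differentiable function has the mollified weak gradient as its gradient, at
all points that are farther from the complement of `D` than the mollification radius. The weak
gradient is tested with a reflected bump function. -/
theorem gradient_mollify {D : Set Plane} (hD : IsOpen D) (η : ContDiffBump (0 : Plane))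
    {f : Plane → ℝ} {g : Plane → Plane} (hfg : HasWeakGrad D f g)
    (hf : LocallyIntegrable (D.indicator f) volume) {x : Plane}
    (hx : Metric.closedBall x η.rOut ⊆ D) :
    gradient (mollify η (D.indicator f)) x = ∫ t in D, η.normed volume (x - t) • g t := by
  have hs : ContDiff ℝ ∞ (η.normed (volume : Measure Plane)) := η.contDiff_normed
  have ht : IsTest D (fun t => η.normed volume (x - t)) := by
    have hsub : tsupport (fun t => η.normed volume (x - t)) ⊆ Metric.closedBall x η.rOut := by
      refine closure_minimal (fun t ht => ?_) Metric.isClosed_closedBall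
      have h1 : x - t ∈ Function.support (η.normed (volume : Measure Plane)) := ht
      rw [η.support_normed_eq] at h1
      rw [Metric.mem_closedBall, dist_comm, dist_eq_norm]
      simpa using (mem_ball_zero_iff.1 h1).le
    refine ⟨hs.comp (contDiff_const.sub contDiff_id), ?_, hsub.trans hx⟩
    exact (isCompact_closedBall x η.rOut).of_isClosed_subset (isClosed_tsupport _) hsub
  have h1 := hfg.2.2 _ ht
  have h2 : ∀ t, gradient (fun t => η.normed volume (x - t)) t
      = - gradient (η.normed volume) (x - t) := fun t => gradient_reflect hs x t
  simp only [h2, smul_neg, integral_neg, neg_inj] at h1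
  rw [gradient_mollify_eq_integral η hf, ← h1, ← integral_indicator hD.measurableSet]
  refine integral_congr_ae (Eventually.of_forall fun t => ?_)
  by_cases htD : t ∈ D <;> simp [htD]

/-! ### Calculus of weak gradients -/

theorem HasWeakGrad.aestronglyMeasurable {D : Set Plane} {f : Plane → ℝ} {g : Plane → Plane}
    (h : HasWeakGrad D f g) : AEStronglyMeasurable f (volume.restrict D) :=
  h.1.aestronglyMeasurable

theorem HasWeakGrad.aestronglyMeasurable_grad {D : Set Plane} {f : Plane → ℝ} {g : Plane → Plane}
    (h : HasWeakGrad D f g) : AEStronglyMeasurable g (volume.restrict D) :=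
  h.2.1.aestronglyMeasurable

theorem HasWeakGrad.congr {D : Set Plane} (hD : IsOpen D) {f f' : Plane → ℝ} {g g' : Plane → Plane}
    (h : HasWeakGrad D f g) (hf : f =ᵐ[volume.restrict D] f') (hg : g =ᵐ[volume.restrict D] g') :
    HasWeakGrad D f' g' := by
  refine ⟨?_, ?_, fun φ hφ => ?_⟩
  · exact locallyIntegrableOn_of_le hD (C := 1) h.1 (h.aestronglyMeasurable.congr hf)
      (hf.mono fun x hx => by rw [hx, one_mul])
  · exact locallyIntegrableOn_of_le hD (C := 1) h.2.1 (h.aestronglyMeasurable_grad.congr hg)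
      (hg.mono fun x hx => by rw [hx, one_mul])
  · have h1 : ∫ x in D, f' x • gradient φ x = ∫ x in D, f x • gradient φ x :=
      integral_congr_ae (hf.mono fun x hx => by simp only [hx])
    have h2 : ∫ x in D, φ x • g' x = ∫ x in D, φ x • g x :=
      integral_congr_ae (hg.mono fun x hx => by simp only [hx])
    rw [h1, h2, h.2.2 φ hφ]

theorem IsTest.integrable_smul {D : Set Plane} {φ : Plane → ℝ} (hφ : IsTest D φ) {E : Type*}
    [NormedAddCommGroup E] [NormedSpace ℝ E] {g : Plane → E} (hg : LocallyIntegrableOn g D volume) :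
    Integrable (fun x => φ x • g x) (volume.restrict D) := by
  obtain ⟨C, hC⟩ := hφ.2.1.isCompact.exists_bound_of_continuousOn hφ.1.continuous.continuousOn
  refine integrable_of_le_on_compact (K := tsupport φ) (C := C) hg hφ.2.1.isCompact hφ.2.2
    (hφ.aestronglyMeasurable.1.smul hg.aestronglyMeasurable) (Eventually.of_forall fun x hx => ?_)
    (fun x hx => ?_)
  · rw [norm_smul]
    exact mul_le_mul_of_nonneg_right (hC x hx) (norm_nonneg _)
  · rw [image_eq_zero_of_notMem_tsupport hx, zero_smul]

theorem IsTest.integrable_smul_gradient {D : Set Plane} {φ : Plane → ℝ} (hφ : IsTest D φ)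
    {f : Plane → ℝ} (hf : LocallyIntegrableOn f D volume) :
    Integrable (fun x => f x • gradient φ x) (volume.restrict D) := by
  obtain ⟨C, hC⟩ := hφ.2.1.isCompact.exists_bound_of_continuousOn
    (continuous_gradient hφ.1).continuousOn
  refine integrable_of_le_on_compact (K := tsupport φ) (C := C) hf hφ.2.1.isCompact hφ.2.2
    (hf.aestronglyMeasurable.smul hφ.aestronglyMeasurable.2) (Eventually.of_forall fun x hx => ?_)
    (fun x hx => ?_)
  · rw [norm_smul, mul_comm]
    exact mul_le_mul_of_nonneg_right (hC x hx) (norm_nonneg _)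
  · rw [gradient_eq_zero_of_notMem_tsupport hx, smul_zero]

theorem HasWeakGrad.unique {D : Set Plane} (hD : IsOpen D) {f : Plane → ℝ} {g g' : Plane → Plane}
    (h : HasWeakGrad D f g) (h' : HasWeakGrad D f g') : g =ᵐ[volume.restrict D] g' := by
  have h1 := hD.ae_eq_zero_of_integral_contDiff_smul_eq_zero (μ := volume) (h.2.1.sub h'.2.1)
    (fun φ hφ hc hs => ?_)
  · rw [EventuallyEq, ae_restrict_iff' hD.measurableSet]
    filter_upwards [h1] with x hx hxD
    exact sub_eq_zero.1 (hx hxD)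
  · have ht : IsTest D φ := ⟨hφ, hc, hs⟩
    have h2 : ∫ x, φ x • (g - g') x = ∫ x in D, φ x • (g - g') x := by
      refine (setIntegral_eq_integral_of_forall_compl_eq_zero fun x hx => ?_).symm
      rw [image_eq_zero_of_notMem_tsupport fun hx' => hx (hs hx'), zero_smul]
    rw [h2]
    simp only [Pi.sub_apply, smul_sub]
    rw [integral_sub (ht.integrable_smul h.2.1) (ht.integrable_smul h'.2.1), sub_eq_zero]
    exact neg_injective (by rw [← h.2.2 φ ht, ← h'.2.2 φ ht])

theorem HasWeakGrad.sub {D : Set Plane} {f f' : Plane → ℝ} {g g' : Plane → Plane}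
    (h : HasWeakGrad D f g) (h' : HasWeakGrad D f' g') :
    HasWeakGrad D (fun x => f x - f' x) (fun x => g x - g' x) := by
  refine ⟨h.1.sub h'.1, h.2.1.sub h'.2.1, fun φ hφ => ?_⟩
  simp only [sub_smul, smul_sub]
  rw [integral_sub (hφ.integrable_smul_gradient h.1) (hφ.integrable_smul_gradient h'.1),
    integral_sub (hφ.integrable_smul h.2.1) (hφ.integrable_smul h'.2.1), h.2.2 φ hφ, h'.2.2 φ hφ]
  abel

theorem IsTest.mul_contDiff {D : Set Plane} {φ s : Plane → ℝ} (hφ : IsTest D φ)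
    (hs : ContDiff ℝ ∞ s) : IsTest D (fun x => φ x * s x) :=
  ⟨hφ.1.mul hs, hφ.2.1.mul_right, (tsupport_mul_subset_left).trans hφ.2.2⟩

/-- `b` is bounded by `C` and has a weak gradient `gb` that is bounded by `C`. -/
structure IsW1Infty (D : Set Plane) (b : Plane → ℝ) (gb : Plane → Plane) (C : ℝ) : Prop where
  grad : HasWeakGrad D b gb
  nonneg : 0 ≤ C
  le : ∀ᵐ x ∂(volume.restrict D), ‖b x‖ ≤ C
  le_grad : ∀ᵐ x ∂(volume.restrict D), ‖gb x‖ ≤ C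

/-- On compact subsets of `D`, the function `b` and its weak gradient `gb` are the almost everywhere
limits of uniformly bounded smooth functions and of their gradients. -/
def HasSmoothApprox (D : Set Plane) (b : Plane → ℝ) (gb : Plane → Plane) : Prop :=
  ∀ K ⊆ D, IsCompact K → ∃ (s : ℕ → Plane → ℝ) (C : ℝ), (∀ n, ContDiff ℝ ∞ (s n)) ∧
    (∀ n, ∀ x ∈ K, ‖s n x‖ ≤ C ∧ ‖gradient (s n) x‖ ≤ C) ∧
    ∀ᵐ x ∂(volume.restrict D), x ∈ K → Tendsto (fun n => s n x) atTop (𝓝 (b x)) ∧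
      Tendsto (fun n => gradient (s n) x) atTop (𝓝 (gb x))

/-- Mollified functions converge, with their gradients, to a bounded function with bounded weak
gradient; mollification keeps the sign. -/
theorem IsW1Infty.exists_mollified {D : Set Plane} (hD : IsOpen D) {b : Plane → ℝ}
    {gb : Plane → Plane} {C : ℝ} (h : IsW1Infty D b gb C) {K : Set Plane} (hKD : K ⊆ D)
    (hK : IsCompact K) : ∃ s : ℕ → Plane → ℝ, (∀ n, ContDiff ℝ ∞ (s n)) ∧
    (∀ n, ∀ x ∈ K, ‖s n x‖ ≤ C ∧ ‖gradient (s n) x‖ ≤ C) ∧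
    (∀ᵐ x ∂(volume.restrict D), x ∈ K → Tendsto (fun n => s n x) atTop (𝓝 (b x)) ∧
      Tendsto (fun n => gradient (s n) x) atTop (𝓝 (gb x))) ∧
    ((∀ᵐ x ∂(volume.restrict D), 0 ≤ b x) → ∀ n x, 0 ≤ s n x) := by
  obtain ⟨δ, hδ, hsub⟩ := hK.exists_cthickening_subset_open hD hKD
  have hball : ∀ n, ∀ x ∈ K, Metric.closedBall x (bump δ hδ n).rOut ⊆ D := fun n x hx =>
    (Metric.closedBall_subset_closedBall (bump_rOut_le hδ n)).trans
      ((Metric.closedBall_subset_cthickening hx δ).trans hsub)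
  have hb : LocallyIntegrable (D.indicator b) volume :=
    locallyIntegrable_indicator_of_bound hD h.grad.aestronglyMeasurable h.le
  have hgb : LocallyIntegrable (D.indicator gb) volume :=
    locallyIntegrable_indicator_of_bound hD h.grad.aestronglyMeasurable_grad h.le_grad
  have hbC : ∀ᵐ x, ‖D.indicator b x‖ ≤ C := by
    filter_upwards [(ae_restrict_iff' hD.measurableSet).1 h.le] with x hx
    by_cases hxD : x ∈ D
    · simpa [hxD] using hx hxD
    · simpa [hxD] using h.nonneg
  have hgbC : ∀ᵐ x, ‖D.indicator gb x‖ ≤ C := by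
    filter_upwards [(ae_restrict_iff' hD.measurableSet).1 h.le_grad] with x hx
    by_cases hxD : x ∈ D
    · simpa [hxD] using hx hxD
    · simpa [hxD] using h.nonneg
  have hgrad : ∀ n, ∀ x ∈ K, gradient (mollify (bump δ hδ n) (D.indicator b)) x
      = mollify (bump δ hδ n) (D.indicator gb) x := by
    intro n x hx
    rw [gradient_mollify hD _ h.grad hb (hball n x hx), mollify, ← integral_indicator
      hD.measurableSet]
    congr 1
    funext t
    by_cases ht : t ∈ D <;> simp [ht]
  refine ⟨fun n => mollify (bump δ hδ n) (D.indicator b), fun n => contDiff_mollify _ hb,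
    fun n x hx => ⟨norm_mollify_le _ hbC x, ?_⟩, ?_, fun h0 n x => mollify_nonneg _ ?_ x⟩
  · rw [hgrad n x hx]
    exact norm_mollify_le _ hgbC x
  · rw [ae_restrict_iff' hD.measurableSet]
    filter_upwards [ae_tendsto_mollify hδ hb, ae_tendsto_mollify hδ hgb] with x h1 h2 hxD hxK
    rw [indicator_of_mem hxD] at h1 h2
    refine ⟨h1, h2.congr fun n => (hgrad n x hxK).symm⟩
  · filter_upwards [(ae_restrict_iff' hD.measurableSet).1 h0] with x hx
    by_cases hxD : x ∈ D
    · simpa [hxD] using hx hxD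
    · simp [hxD]

theorem IsW1Infty.hasSmoothApprox {D : Set Plane} (hD : IsOpen D) {b : Plane → ℝ}
    {gb : Plane → Plane} {C : ℝ} (h : IsW1Infty D b gb C) : HasSmoothApprox D b gb := by
  intro K hKD hK
  obtain ⟨s, h1, h2, h3, -⟩ := h.exists_mollified hD hKD hK
  exact ⟨s, C, h1, h2, h3⟩

/-- The product rule. The weak gradient of `w` is tested with the products of a test function and
smooth approximations of `b`. -/
theorem HasWeakGrad.mul {D : Set Plane} (hD : IsOpen D) {b w : Plane → ℝ} {gb gw : Plane → Plane}
    {C : ℝ} (hw : HasWeakGrad D w gw) (hb : HasSmoothApprox D b gb)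
    (hbm : AEStronglyMeasurable b (volume.restrict D))
    (hgbm : AEStronglyMeasurable gb (volume.restrict D))
    (hbC : ∀ᵐ x ∂(volume.restrict D), ‖b x‖ ≤ C)
    (hgbC : ∀ᵐ x ∂(volume.restrict D), ‖gb x‖ ≤ C) :
    HasWeakGrad D (fun x => b x * w x) (fun x => b x • gw x + w x • gb x) := by
  have l1 : LocallyIntegrableOn (fun x => b x * w x) D volume := by
    refine locallyIntegrableOn_of_le hD (C := C) hw.1 (hbm.mul hw.aestronglyMeasurable)
      (hbC.mono fun x hx => ?_)
    rw [norm_mul]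
    exact mul_le_mul_of_nonneg_right hx (norm_nonneg _)
  have l2 : LocallyIntegrableOn (fun x => b x • gw x) D volume := by
    refine locallyIntegrableOn_of_le hD (C := C) hw.2.1 (hbm.smul hw.aestronglyMeasurable_grad)
      (hbC.mono fun x hx => ?_)
    rw [norm_smul]
    exact mul_le_mul_of_nonneg_right hx (norm_nonneg _)
  have l3 : LocallyIntegrableOn (fun x => w x • gb x) D volume := by
    refine locallyIntegrableOn_of_le hD (C := C) hw.1 (hw.aestronglyMeasurable.smul hgbm)
      (hgbC.mono fun x hx => ?_)
    rw [norm_smul, mul_comm]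
    exact mul_le_mul_of_nonneg_right hx (norm_nonneg _)
  refine ⟨l1, l2.add l3, fun φ hφ => ?_⟩
  have hKc := hφ.2.1.isCompact
  obtain ⟨s, B, hs, hsB, hsl⟩ := hb (tsupport φ) hφ.2.2 hKc
  obtain ⟨P, hP⟩ := hKc.exists_bound_of_continuousOn hφ.1.continuous.continuousOn
  obtain ⟨Q, hQ⟩ := hKc.exists_bound_of_continuousOn (continuous_gradient hφ.1).continuousOn
  have e : ∀ n, ∫ x in D, w x • (φ x • gradient (s n) x + s n x • gradient φ x)
      = - ∫ x in D, (φ x * s n x) • gw x := by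
    intro n
    rw [← hw.2.2 _ (hφ.mul_contDiff (hs n))]
    exact integral_congr_ae (Eventually.of_forall fun x => by
      simp only [gradient_mul_fun hφ.1 (hs n)])
  have t1 : Tendsto (fun n => ∫ x in D, w x • (φ x • gradient (s n) x + s n x • gradient φ x))
      atTop (𝓝 (∫ x in D, w x • (φ x • gb x + b x • gradient φ x))) := by
    refine tendsto_integral_of_le_on_compact (K := tsupport φ) (C := P * B + B * Q) hw.1 hKc
      hφ.2.2 (fun n => ?_) (fun n => Eventually.of_forall fun x hx => ?_) (fun n x hx => ?_)
      (fun x hx => ?_) ?_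
    · exact hw.aestronglyMeasurable.smul
        (((hφ.1.continuous.smul (continuous_gradient (hs n))).add
          ((hs n).continuous.smul (continuous_gradient hφ.1))).aestronglyMeasurable)
    · rw [norm_smul, mul_comm]
      refine mul_le_mul_of_nonneg_right ((norm_add_le _ _).trans ?_) (norm_nonneg _)
      rw [norm_smul, norm_smul]
      have h1 := hP x hx
      have h2 := hQ x hx
      have h3 := hsB n x hx
      have hB : 0 ≤ B := (norm_nonneg _).trans h3.1
      exact add_le_add (mul_le_mul h1 h3.2 (norm_nonneg _) ((norm_nonneg _).trans h1))
        (mul_le_mul h3.1 h2 (norm_nonneg _) hB)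
    · rw [image_eq_zero_of_notMem_tsupport hx, gradient_eq_zero_of_notMem_tsupport hx]
      simp
    · rw [image_eq_zero_of_notMem_tsupport hx, gradient_eq_zero_of_notMem_tsupport hx]
      simp
    · filter_upwards [hsl] with x hx hxK
      exact (((hx hxK).2.const_smul (φ x)).add ((hx hxK).1.smul_const _)).const_smul (w x)
  have t2 : Tendsto (fun n => ∫ x in D, (φ x * s n x) • gw x) atTop
      (𝓝 (∫ x in D, (φ x * b x) • gw x)) := by
    refine tendsto_integral_of_le_on_compact (K := tsupport φ) (C := P * B) hw.2.1 hKc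
      hφ.2.2 (fun n => ?_) (fun n => Eventually.of_forall fun x hx => ?_) (fun n x hx => ?_)
      (fun x hx => ?_) ?_
    · exact (hφ.1.continuous.mul (hs n).continuous).aestronglyMeasurable.smul
        hw.aestronglyMeasurable_grad
    · rw [norm_smul, norm_mul]
      refine mul_le_mul_of_nonneg_right ?_ (norm_nonneg _)
      have h1 := hP x hx
      exact mul_le_mul h1 (hsB n x hx).1 (norm_nonneg _) ((norm_nonneg _).trans h1)
    · rw [image_eq_zero_of_notMem_tsupport hx]; simp
    · rw [image_eq_zero_of_notMem_tsupport hx]; simp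
    · filter_upwards [hsl] with x hx hxK
      exact ((hx hxK).1.const_mul (φ x)).smul_const _
  have key := tendsto_nhds_unique (t1.congr e) t2.neg
  have i1 := hφ.integrable_smul_gradient l1
  have i2 := hφ.integrable_smul l2
  have i3 := hφ.integrable_smul l3
  have e1 : ∫ x in D, w x • (φ x • gb x + b x • gradient φ x)
      = (∫ x in D, φ x • (w x • gb x)) + ∫ x in D, (b x * w x) • gradient φ x := by
    rw [← integral_add i3 i1]
    refine integral_congr_ae (Eventually.of_forall fun x => ?_)
    dsimp only
    module
  have e2 : ∫ x in D, (φ x * b x) • gw x = ∫ x in D, φ x • (b x • gw x) := by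
    simp only [mul_smul]
  have e3 : ∫ x in D, φ x • (b x • gw x + w x • gb x)
      = (∫ x in D, φ x • (b x • gw x)) + ∫ x in D, φ x • (w x • gb x) := by
    rw [← integral_add i2 i3]
    simp only [smul_add]
  rw [e1, e2] at key
  rw [e3, ← sub_eq_zero, ← sub_eq_zero.2 key]
  abel

theorem hasWeakGrad_of_contDiff {D : Set Plane} {ψ : Plane → ℝ}
    (hψ : ContDiff ℝ ∞ ψ) : HasWeakGrad D ψ (gradient ψ) := by
  have l1 : LocallyIntegrableOn ψ D volume :=
    hψ.continuous.locallyIntegrable.locallyIntegrableOn D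
  have l2 : LocallyIntegrableOn (gradient ψ) D volume :=
    (continuous_gradient hψ).locallyIntegrable.locallyIntegrableOn D
  refine ⟨l1, l2, fun φ hφ => ?_⟩
  have c1 : Continuous fun x => ψ x • gradient φ x :=
    hψ.continuous.smul (continuous_gradient hφ.1)
  have c2 : Continuous fun x => φ x • gradient ψ x :=
    hφ.1.continuous.smul (continuous_gradient hψ)
  have i1 : Integrable (fun x => ψ x • gradient φ x) volume := by
    refine c1.integrable_of_hasCompactSupport (hφ.2.1.mono' fun x hx => ?_)
    by_contra h
    exact hx (by simp only [gradient_eq_zero_of_notMem_tsupport h, smul_zero])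
  have i2 : Integrable (fun x => φ x • gradient ψ x) volume :=
    c2.integrable_of_hasCompactSupport hφ.2.1.smul_right
  have i3 : Integrable (fun x => ψ x * φ x) volume :=
    (hψ.continuous.mul hφ.1.continuous).integrable_of_hasCompactSupport hφ.2.1.mul_left
  have e1 : ∫ x in D, ψ x • gradient φ x = ∫ x, ψ x • gradient φ x := by
    refine setIntegral_eq_integral_of_forall_compl_eq_zero fun x hx => ?_
    rw [gradient_eq_zero_of_notMem_tsupport fun hx' => hx (hφ.2.2 hx'), smul_zero]
  have e2 : ∫ x in D, φ x • gradient ψ x = ∫ x, φ x • gradient ψ x := by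
    refine setIntegral_eq_integral_of_forall_compl_eq_zero fun x hx => ?_
    rw [image_eq_zero_of_notMem_tsupport fun hx' => hx (hφ.2.2 hx'), zero_smul]
  have hin : ∀ (f : Plane → ℝ) (x v : Plane), inner ℝ v (gradient f x) = fderiv ℝ f x v := by
    intro f x v
    rw [real_inner_comm]
    exact InnerProductSpace.toDual_symm_apply
  rw [e1, e2]
  refine ext_inner_left ℝ fun v => ?_
  rw [inner_neg_right, ← integral_inner i1, ← integral_inner i2]
  have k1 := i1.const_inner (𝕜 := ℝ) v
  have k2 := i2.const_inner (𝕜 := ℝ) v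
  simp only [inner_smul_right, hin] at k1 k2 ⊢
  rw [integral_mul_fderiv_eq_neg_fderiv_mul_of_integrable (by simpa only [mul_comm] using k2) k1 i3
    (fun x _ => hψ.differentiable (by simp) x) (fun x _ => hφ.1.differentiable (by simp) x)]
  simp only [mul_comm]

/-- Smooth approximations of `1 / b` for `b ≥ c > 0` are the reciprocals of `c` plus mollifications
of `b - c`; these are at least `c` everywhere. -/
theorem IsW1Infty.hasSmoothApprox_inv {D : Set Plane} (hD : IsOpen D) {b : Plane → ℝ}
    {gb : Plane → Plane} {c C : ℝ} (hc : 0 < c) (h : IsW1Infty D b gb C)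
    (hcb : ∀ᵐ x ∂(volume.restrict D), c ≤ b x) :
    HasSmoothApprox D (fun x => (b x)⁻¹) (fun x => -((b x ^ 2)⁻¹ • gb x)) := by
  intro K hKD hK
  have hg0 : ∀ x : Plane, gradient (fun _ : Plane => c) x = 0 := by
    intro x; simp [gradient]
  have h1 : IsW1Infty D (fun x => b x - c) gb (C + c) := by
    refine ⟨?_, by linarith [h.nonneg], ?_, ?_⟩
    · have := h.grad.sub (hasWeakGrad_of_contDiff (contDiff_const (c := c)))
      simpa only [hg0, sub_zero] using this
    · filter_upwards [h.le] with x hx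
      exact (norm_sub_le _ _).trans (add_le_add hx (by rw [Real.norm_of_nonneg hc.le]))
    · filter_upwards [h.le_grad] with x hx
      linarith
  obtain ⟨s, hs, hsB, hsl, hs0⟩ := h1.exists_mollified hD hKD hK
  have hs1 : ∀ n x, c ≤ c + s n x := fun n x =>
    le_add_of_nonneg_right (hs0 (hcb.mono fun x hx => sub_nonneg.2 hx) n x)
  have hne : ∀ n x, c + s n x ≠ 0 := fun n x => (hc.trans_le (hs1 n x)).ne'
  have hcd : ∀ n, ContDiff ℝ ∞ fun x => c + s n x := fun n => contDiff_const.add (hs n)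
  have hgr : ∀ n x, gradient (fun z => (c + s n z)⁻¹) x
      = -(((c + s n x) ^ 2)⁻¹ • gradient (s n) x) := by
    intro n x
    rw [gradient_inv_fun (hcd n) (hne n), gradient_add_fun contDiff_const (hs n), hg0, zero_add]
  refine ⟨fun n x => (c + s n x)⁻¹, max c⁻¹ ((c ^ 2)⁻¹ * (C + c)), fun n => (hcd n).inv (hne n),
    fun n x hx => ⟨?_, ?_⟩, ?_⟩
  · rw [norm_inv, Real.norm_of_nonneg (hc.le.trans (hs1 n x))]
    exact (inv_anti₀ hc (hs1 n x)).trans (le_max_left _ _)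
  · rw [hgr, norm_neg, norm_smul, norm_inv, norm_pow, Real.norm_of_nonneg (hc.le.trans (hs1 n x))]
    refine le_trans ?_ (le_max_right _ _)
    exact mul_le_mul (inv_anti₀ (by positivity) (pow_le_pow_left₀ hc.le (hs1 n x) 2))
      (hsB n x hx).2 (norm_nonneg _) (by positivity)
  · filter_upwards [hsl, hcb] with x hx hcx hxK
    have hb0 : b x ≠ 0 := (hc.trans_le hcx).ne'
    have t1 : Tendsto (fun n => c + s n x) atTop (𝓝 (b x)) := by
      simpa using (hx hxK).1.const_add c
    refine ⟨t1.inv₀ hb0, ?_⟩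
    simp only [hgr]
    exact (((t1.pow 2).inv₀ (pow_ne_zero 2 hb0)).smul (hx hxK).2).neg

/-- The chain rule for squares of bounded functions. The weak gradient `ga` is merely locally
integrable, so the term with the gradient of the mollified function is treated by moving the
mollification to the other factor. -/
theorem HasWeakGrad.sq {D : Set Plane} (hD : IsOpen D) {a : Plane → ℝ} {ga : Plane → Plane} {C : ℝ}
    (h : HasWeakGrad D a ga) (hC : 0 ≤ C) (haC : ∀ᵐ x ∂(volume.restrict D), ‖a x‖ ≤ C) :
    HasWeakGrad D (fun x => a x ^ 2) (fun x => (2 * a x) • ga x) := by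
  have l1 : LocallyIntegrableOn (fun x => a x ^ 2) D volume := by
    refine locallyIntegrableOn_of_bound hD (C := C ^ 2) (h.aestronglyMeasurable.pow 2) ?_
    filter_upwards [haC] with x hx
    rw [norm_pow]
    exact pow_le_pow_left₀ (norm_nonneg _) hx 2
  have l2 : LocallyIntegrableOn (fun x => a x • ga x) D volume := by
    refine locallyIntegrableOn_of_le hD (C := C) h.2.1
      (h.aestronglyMeasurable.smul h.aestronglyMeasurable_grad) (haC.mono fun x hx => ?_)
    rw [norm_smul]
    exact mul_le_mul_of_nonneg_right hx (norm_nonneg _)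
  have l3 : LocallyIntegrableOn (fun x => (2 * a x) • ga x) D volume := by
    refine locallyIntegrableOn_of_le hD (C := 2) l2
      ((h.aestronglyMeasurable.const_mul 2).smul h.aestronglyMeasurable_grad)
      (Eventually.of_forall fun x => ?_)
    rw [mul_smul, norm_smul, Real.norm_two]
  refine ⟨l1, l3, fun φ hφ => ?_⟩
  have hKc := hφ.2.1.isCompact
  obtain ⟨P, hP⟩ := hKc.exists_bound_of_continuousOn hφ.1.continuous.continuousOn
  obtain ⟨Q, hQ⟩ := hKc.exists_bound_of_continuousOn (continuous_gradient hφ.1).continuousOn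
  obtain ⟨δ, hδ, hsub⟩ := hKc.exists_cthickening_subset_open hD hφ.2.2
  have hK'c : IsCompact (Metric.cthickening δ (tsupport φ)) := hKc.cthickening
  have hball : ∀ n, ∀ x ∈ tsupport φ, Metric.closedBall x (bump δ hδ n).rOut ⊆
      Metric.cthickening δ (tsupport φ) := fun n x hx =>
    (Metric.closedBall_subset_closedBall (bump_rOut_le hδ n)).trans
      (Metric.closedBall_subset_cthickening hx δ)
  have hind : ∀ {b : Plane → ℝ} {B : ℝ}, 0 ≤ B → (∀ᵐ x ∂(volume.restrict D), ‖b x‖ ≤ B) →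
      ∀ᵐ x, ‖D.indicator b x‖ ≤ B := by
    intro b B hB hb
    filter_upwards [(ae_restrict_iff' hD.measurableSet).1 hb] with x hx
    by_cases hxD : x ∈ D
    · simpa [hxD] using hx hxD
    · simpa [hxD] using hB
  have ha0 : LocallyIntegrable (D.indicator a) volume :=
    locallyIntegrable_indicator_of_bound hD h.aestronglyMeasurable haC
  set s : ℕ → Plane → ℝ := fun n => mollify (bump δ hδ n) (D.indicator a) with hs_def
  have hs : ∀ n, ContDiff ℝ ∞ (s n) := fun n => contDiff_mollify _ ha0
  have hsC : ∀ n x, ‖s n x‖ ≤ C := fun n x => norm_mollify_le _ (hind hC haC) x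
  have hsl : ∀ᵐ x ∂(volume.restrict D), Tendsto (fun n => s n x) atTop (𝓝 (a x)) := by
    rw [ae_restrict_iff' hD.measurableSet]
    filter_upwards [ae_tendsto_mollify hδ ha0] with x h1 hxD
    rwa [indicator_of_mem hxD] at h1
  -- `P` bounds `φ` on its support only, and may be negative if the support is empty
  have hP' : ∀ x, ‖φ x‖ ≤ max P 0 := by
    intro x
    by_cases hx : x ∈ tsupport φ
    · exact (hP x hx).trans (le_max_left _ _)
    · rw [image_eq_zero_of_notMem_tsupport hx, norm_zero]; exact le_max_right _ _
  have hpm : AEStronglyMeasurable (fun x => a x * φ x) (volume.restrict D) :=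
    h.aestronglyMeasurable.mul hφ.aestronglyMeasurable.1
  have hpC : ∀ᵐ x ∂(volume.restrict D), ‖a x * φ x‖ ≤ C * max P 0 := by
    filter_upwards [haC] with x hx
    rw [norm_mul]
    exact mul_le_mul hx (hP' x) (norm_nonneg _) hC
  have hp0 : LocallyIntegrable (D.indicator fun x => a x * φ x) volume :=
    locallyIntegrable_indicator_of_bound hD hpm hpC
  -- the mollifications of `a φ` vanish off a fixed compact neighbourhood of the support of `φ`
  set p : ℕ → Plane → ℝ := fun n => mollify (bump δ hδ n) (D.indicator fun x => a x * φ x)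
    with hp_def
  have hpcont : ∀ n, Continuous (p n) := fun n => (contDiff_mollify _ hp0).continuous
  have hpB : ∀ n x, ‖p n x‖ ≤ C * max P 0 := fun n x =>
    norm_mollify_le _ (hind (mul_nonneg hC (le_max_right _ _)) hpC) x
  have hpl : ∀ᵐ x ∂(volume.restrict D), Tendsto (fun n => p n x) atTop (𝓝 (a x * φ x)) := by
    rw [ae_restrict_iff' hD.measurableSet]
    filter_upwards [ae_tendsto_mollify hδ hp0] with x h1 hxD
    rwa [indicator_of_mem hxD] at h1
  have hη0 : ∀ n x t, x ∈ tsupport φ → t ∉ Metric.cthickening δ (tsupport φ) →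
      (bump δ hδ n).normed volume (x - t) = 0 := by
    intro n x t hx ht
    by_contra hne
    have h1 : x - t ∈ Function.support ((bump δ hδ n).normed (volume : Measure Plane)) := hne
    rw [(bump δ hδ n).support_normed_eq] at h1
    refine ht (hball n x hx ?_)
    rw [Metric.mem_closedBall, dist_comm, dist_eq_norm]
    exact (mem_ball_zero_iff.1 h1).le
  have hp_zero : ∀ n t, t ∉ Metric.cthickening δ (tsupport φ) → p n t = 0 := by
    intro n t ht
    refine (integral_congr_ae (Eventually.of_forall fun x => ?_)).trans (integral_zero _ _)
    by_cases hx : x ∈ tsupport φ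
    · have := hη0 n x t hx ht
      rw [← neg_sub, (bump δ hδ n).normed_neg] at this
      simp [this]
    · by_cases hxD : x ∈ D <;> simp [hxD, image_eq_zero_of_notMem_tsupport hx]
  -- the mollification is moved from `ga` to `a φ`
  have swap : ∀ n, ∫ x in D, (a x * φ x) • gradient (s n) x = ∫ t in D, p n t • ga t := by
    intro n
    set η := (bump δ hδ n).normed (volume : Measure Plane) with hη
    have hηc : Continuous η := (bump δ hδ n).continuous_normed
    obtain ⟨B, hB⟩ := ((bump δ hδ n).hasCompactSupport_normed
      (μ := (volume : Measure Plane))).exists_bound_of_continuous hηc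
    -- Fubini's theorem needs `ga` to be integrable, so `ga` is cut off where the kernel vanishes
    set g0 := (Metric.cthickening δ (tsupport φ)).indicator ga with hg0
    have hg0i : Integrable g0 (volume.restrict D) := by
      rw [hg0, integrable_indicator_iff hK'c.measurableSet]
      have h3 : IntegrableOn ga (Metric.cthickening δ (tsupport φ)) volume :=
        h.2.1.integrableOn_compact_subset hsub hK'c
      exact h3.mono_measure Measure.restrict_le_self
    have hpi : Integrable (fun x => a x * φ x) (volume.restrict D) := by
      simpa only [smul_eq_mul, mul_comm] using hφ.integrable_smul h.1
    have hI : Integrable (fun z : Plane × Plane => η (z.1 - z.2) • ((a z.1 * φ z.1) • g0 z.2))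
        ((volume.restrict D).prod (volume.restrict D)) := by
      refine (hpi.smul_prod hg0i).bdd_smul (C := B) ?_ (Eventually.of_forall fun z => hB _)
      exact (hηc.comp (continuous_fst.sub continuous_snd)).aestronglyMeasurable
    have hF : ∀ x t, η (x - t) • ((a x * φ x) • g0 t) = (a x * φ x) • (η (x - t) • ga t) := by
      intro x t
      rw [smul_comm]
      by_cases hx : x ∈ tsupport φ
      · by_cases ht : t ∈ Metric.cthickening δ (tsupport φ)
        · rw [hg0, indicator_of_mem ht]
        · rw [show η (x - t) = 0 from hη0 n x t hx ht, zero_smul, zero_smul]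
      · rw [image_eq_zero_of_notMem_tsupport hx, mul_zero, zero_smul, zero_smul]
    have e1 : ∀ x, (a x * φ x) • gradient (s n) x
        = ∫ t in D, η (x - t) • ((a x * φ x) • g0 t) := by
      intro x
      simp only [hF, integral_smul]
      by_cases hx : x ∈ tsupport φ
      · rw [hs_def, gradient_mollify hD _ h ha0 ((hball n x hx).trans hsub)]
      · rw [image_eq_zero_of_notMem_tsupport hx, mul_zero, zero_smul, zero_smul]
    simp only [e1]
    rw [integral_integral_swap hI]
    refine integral_congr_ae (Eventually.of_forall fun t => ?_)
    dsimp only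
    simp only [hF]
    have e2 : ∀ x, (a x * φ x) • (η (x - t) • ga t) = (η (t - x) * (a x * φ x)) • ga t := by
      intro x
      rw [← neg_sub, hη, (bump δ hδ n).normed_neg, smul_smul, mul_comm]
    simp only [e2]
    rw [integral_smul_const, ← integral_indicator hD.measurableSet]
    congr 1
    change _ = ∫ x, η (t - x) • D.indicator (fun x => a x * φ x) x
    congr 1
    funext x
    by_cases hxD : x ∈ D <;> simp [hxD]
  have e : ∀ n, (∫ t in D, p n t • ga t) + ∫ x in D, (a x * s n x) • gradient φ x
      = - ∫ x in D, (φ x * s n x) • ga x := by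
    intro n
    have i1 : Integrable (fun x => (a x * φ x) • gradient (s n) x) (volume.restrict D) := by
      obtain ⟨B, hB⟩ := hKc.exists_bound_of_continuousOn (continuous_gradient (hs n)).continuousOn
      refine integrable_of_le_on_compact (K := tsupport φ) (C := max P 0 * B) h.1 hKc hφ.2.2
        (hpm.smul (continuous_gradient (hs n)).aestronglyMeasurable)
        (Eventually.of_forall fun x hx => ?_) (fun x hx => ?_)
      · rw [norm_smul, norm_mul]
        calc ‖a x‖ * ‖φ x‖ * ‖gradient (s n) x‖
            = ‖φ x‖ * ‖gradient (s n) x‖ * ‖a x‖ := by ring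
          _ ≤ max P 0 * B * ‖a x‖ := mul_le_mul_of_nonneg_right
              (mul_le_mul (hP' x) (hB x hx) (norm_nonneg _) (le_max_right _ _)) (norm_nonneg _)
      · rw [image_eq_zero_of_notMem_tsupport hx, mul_zero, zero_smul]
    have i2 : Integrable (fun x => (a x * s n x) • gradient φ x) (volume.restrict D) := by
      refine hφ.integrable_smul_gradient (locallyIntegrableOn_of_le hD (C := C) h.1
        (h.aestronglyMeasurable.mul (hs n).continuous.aestronglyMeasurable)
        (Eventually.of_forall fun x => ?_))
      rw [norm_mul, mul_comm]
      exact mul_le_mul_of_nonneg_right (hsC n x) (norm_nonneg _)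
    rw [← h.2.2 _ (hφ.mul_contDiff (hs n)), ← swap n, ← integral_add i1 i2]
    refine integral_congr_ae (Eventually.of_forall fun x => ?_)
    dsimp only
    rw [gradient_mul_fun hφ.1 (hs n)]
    module
  have t1 : Tendsto (fun n => ∫ x in D, (a x * s n x) • gradient φ x) atTop
      (𝓝 (∫ x in D, (a x * a x) • gradient φ x)) := by
    refine tendsto_integral_of_le_on_compact (K := tsupport φ) (C := C * Q) h.1 hKc
      hφ.2.2 (fun n => ?_) (fun n => Eventually.of_forall fun x hx => ?_) (fun n x hx => ?_)
      (fun x hx => ?_) ?_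
    · exact (h.aestronglyMeasurable.mul (hs n).continuous.aestronglyMeasurable).smul
        hφ.aestronglyMeasurable.2
    · rw [norm_smul, norm_mul]
      calc ‖a x‖ * ‖s n x‖ * ‖gradient φ x‖ = ‖s n x‖ * ‖gradient φ x‖ * ‖a x‖ := by ring
        _ ≤ C * Q * ‖a x‖ := mul_le_mul_of_nonneg_right
            (mul_le_mul (hsC n x) (hQ x hx) (norm_nonneg _) hC) (norm_nonneg _)
    · rw [gradient_eq_zero_of_notMem_tsupport hx, smul_zero]
    · rw [gradient_eq_zero_of_notMem_tsupport hx, smul_zero]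
    · filter_upwards [hsl] with x hx _
      exact (hx.const_mul _).smul_const _
  have t2 : Tendsto (fun n => ∫ t in D, p n t • ga t) atTop
      (𝓝 (∫ t in D, (a t * φ t) • ga t)) := by
    refine tendsto_integral_of_le_on_compact (K := Metric.cthickening δ (tsupport φ))
      (C := C * max P 0) h.2.1 hK'c
      hsub (fun n => ?_) (fun n => Eventually.of_forall fun x hx => ?_) (fun n x hx => ?_)
      (fun x hx => ?_) ?_
    · exact (hpcont n).aestronglyMeasurable.smul h.aestronglyMeasurable_grad
    · rw [norm_smul]
      exact mul_le_mul_of_nonneg_right (hpB n x) (norm_nonneg _)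
    · rw [hp_zero n x hx, zero_smul]
    · rw [image_eq_zero_of_notMem_tsupport fun hx' =>
        hx (Metric.self_subset_cthickening _ hx'), mul_zero, zero_smul]
    · filter_upwards [hpl] with x hx _
      exact hx.smul_const _
  have t3 : Tendsto (fun n => ∫ x in D, (φ x * s n x) • ga x) atTop
      (𝓝 (∫ x in D, (φ x * a x) • ga x)) := by
    refine tendsto_integral_of_le_on_compact (K := tsupport φ) (C := max P 0 * C) h.2.1 hKc
      hφ.2.2 (fun n => ?_) (fun n => Eventually.of_forall fun x hx => ?_) (fun n x hx => ?_)
      (fun x hx => ?_) ?_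
    · exact (hφ.1.continuous.mul (hs n).continuous).aestronglyMeasurable.smul
        h.aestronglyMeasurable_grad
    · rw [norm_smul, norm_mul]
      exact mul_le_mul_of_nonneg_right
        (mul_le_mul (hP' x) (hsC n x) (norm_nonneg _) (le_max_right _ _)) (norm_nonneg _)
    · rw [image_eq_zero_of_notMem_tsupport hx, zero_mul, zero_smul]
    · rw [image_eq_zero_of_notMem_tsupport hx, zero_mul, zero_smul]
    · filter_upwards [hsl] with x hx _
      exact (hx.const_mul _).smul_const _
  have key := tendsto_nhds_unique ((t2.add t1).congr e) t3.neg
  have e1 : ∫ x in D, φ x • ((2 * a x) • ga x) = (2 : ℝ) • ∫ x in D, (φ x * a x) • ga x := by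
    rw [← integral_smul]
    refine integral_congr_ae (Eventually.of_forall fun x => ?_)
    dsimp only
    module
  have e2 : ∫ t in D, (a t * φ t) • ga t = ∫ x in D, (φ x * a x) • ga x := by
    simp only [mul_comm]
  simp only [← pow_two] at key
  rw [e2] at key
  rw [e1, two_smul, neg_add, ← sub_eq_add_neg]
  exact eq_sub_of_add_eq' key

theorem IsW1Infty.mul {D : Set Plane} (hD : IsOpen D) {b w : Plane → ℝ} {gb gw : Plane → Plane}
    {C : ℝ} (hb : IsW1Infty D b gb C) (hw : HasWeakGrad D w gw) :
    HasWeakGrad D (fun x => b x * w x) (fun x => b x • gw x + w x • gb x) :=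
  hw.mul hD (hb.hasSmoothApprox hD) hb.grad.aestronglyMeasurable hb.grad.aestronglyMeasurable_grad
    hb.le hb.le_grad

/-- The reciprocal of `a` is written as the product of `1 / a²` and `a`, because `a` may change
sign, whereas `a²` has smooth approximations that are bounded below. -/
theorem HasWeakGrad.inv {D : Set Plane} (hD : IsOpen D) {a : Plane → ℝ} {ga : Plane → Plane}
    {c C : ℝ} (h : HasWeakGrad D a ga) (hc : 0 < c)
    (hca : ∀ᵐ x ∂(volume.restrict D), c ≤ a x ^ 2)
    (ha : IsW1Infty D (fun x => a x ^ 2) (fun x => (2 * a x) • ga x) C) :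
    HasWeakGrad D (fun x => (a x)⁻¹) (fun x => -((a x ^ 2)⁻¹ • ga x)) := by
  have h1 := ha.hasSmoothApprox_inv hD hc hca
  have hm := ha.grad.aestronglyMeasurable
  have hmg := ha.grad.aestronglyMeasurable_grad
  have h2 : ∀ᵐ x ∂(volume.restrict D), ‖(a x ^ 2)⁻¹‖ ≤ max c⁻¹ ((c ^ 2)⁻¹ * C) := by
    filter_upwards [hca] with x hx
    rw [norm_inv, Real.norm_of_nonneg (hc.le.trans hx)]
    exact (inv_anti₀ hc hx).trans (le_max_left _ _)
  have h3 : ∀ᵐ x ∂(volume.restrict D), ‖-(((a x ^ 2) ^ 2)⁻¹ • (2 * a x) • ga x)‖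
      ≤ max c⁻¹ ((c ^ 2)⁻¹ * C) := by
    filter_upwards [hca, ha.le_grad] with x hx hg
    rw [norm_neg, norm_smul, norm_inv, norm_pow, Real.norm_of_nonneg (hc.le.trans hx)]
    refine le_trans ?_ (le_max_right _ _)
    exact mul_le_mul (inv_anti₀ (by positivity) (pow_le_pow_left₀ hc.le hx 2)) hg
      (norm_nonneg _) (by positivity)
  have h4 := h.mul hD h1 hm.inv₀ (((hm.pow 2).inv₀.smul hmg).neg) h2 h3
  refine h4.congr hD ?_ ?_
  · filter_upwards [hca] with x hx
    have hx0 : a x ≠ 0 := by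
      rintro h0
      rw [h0] at hx
      norm_num at hx
      linarith
    field_simp
  · filter_upwards [hca] with x hx
    have hx0 : a x ≠ 0 := by
      rintro h0
      rw [h0] at hx
      norm_num at hx
      linarith
    rw [smul_neg, smul_smul, smul_smul, ← sub_eq_add_neg, ← sub_smul, ← neg_smul]
    congr 1
    field_simp
    ring

theorem IsTest.memLp {D : Set Plane} {φ : Plane → ℝ} (hφ : IsTest D φ) :
    MemLp φ 2 (volume.restrict D) :=
  (hφ.1.continuous.memLp_of_hasCompactSupport hφ.2.1).restrict D

theorem IsTest.memLp_gradient {D : Set Plane} {φ : Plane → ℝ} (hφ : IsTest D φ) :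
    MemLp (gradient φ) 2 (volume.restrict D) := by
  refine ((continuous_gradient hφ.1).memLp_of_hasCompactSupport
    (hφ.2.1.mono' fun x hx => ?_)).restrict D
  by_contra h
  exact hx (gradient_eq_zero_of_notMem_tsupport h)

theorem IsTest.isH10 {D : Set Plane} {φ : Plane → ℝ} (hφ : IsTest D φ) :
    IsH10 D φ (gradient φ) := by
  refine ⟨hφ.memLp, hφ.memLp_gradient, fun _ => φ, fun _ => hφ, ?_, ?_⟩ <;> simp

theorem integral_plane_apply {D : Set Plane} {f : Plane → Plane}
    (hf : Integrable f (volume.restrict D)) (i : Fin 2) :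
    (∫ x in D, f x) i = ∫ x in D, f x i :=
  ((EuclideanSpace.proj i : Plane →L[ℝ] ℝ).integral_comp_comm hf).symm

theorem Plane.inner_eq_sum (v w : Plane) : inner ℝ v w = ∑ i, v i * w i := by
  rw [PiLp.inner_apply]
  simp [mul_comm]

theorem HasWeakGrad.integral_mul_apply {D : Set Plane} {f φ : Plane → ℝ} {g : Plane → Plane}
    (h : HasWeakGrad D f g) (hφ : IsTest D φ) (i : Fin 2) :
    ∫ x in D, f x * gradient φ x i = - ∫ x in D, φ x * g x i := by
  have h1 := congrArg (fun v : Plane => v i) (h.2.2 φ hφ)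
  simp only [PiLp.neg_apply] at h1
  rw [integral_plane_apply (hφ.integrable_smul_gradient h.1),
    integral_plane_apply (hφ.integrable_smul h.2.1)] at h1
  simpa using h1

theorem tendsto_integral_inner_of_tendsto_eLpNorm {α E : Type*} [MeasurableSpace α]
    {ν : Measure α} [NormedAddCommGroup E] [InnerProductSpace ℝ E] {w f : α → E} {s : ℕ → α → E}
    (hw : MemLp w 2 ν) (hs : ∀ n, MemLp (s n) 2 ν) (hf : MemLp f 2 ν)
    (h : Tendsto (fun n => eLpNorm (fun x => s n x - f x) 2 ν) atTop (𝓝 0)) :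
    Tendsto (fun n => ∫ x, inner ℝ (w x) (s n x) ∂ν) atTop (𝓝 (∫ x, inner ℝ (w x) (f x) ∂ν)) := by
  have h1 := (Lp.tendsto_Lp_iff_tendsto_eLpNorm'' s hs f hf).2 h
  have h2 := (tendsto_const_nhds (x := hw.toLp w)).inner (𝕜 := ℝ) h1
  have h3 : ∀ {g : α → E} (hg : MemLp g 2 ν),
      inner ℝ (hw.toLp w) (hg.toLp g) = ∫ x, inner ℝ (w x) (g x) ∂ν := by
    intro g hg
    rw [L2.inner_def]
    refine integral_congr_ae ?_
    filter_upwards [hw.coeFn_toLp, hg.coeFn_toLp] with x h1 h2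
    rw [h1, h2]
  simpa only [h3] using h2

theorem memLp_apply {α : Type*} [MeasurableSpace α] {ν : Measure α} {g : α → Plane}
    (hg : MemLp g 2 ν) (i : Fin 2) : MemLp (fun x => g x i) 2 ν :=
  (EuclideanSpace.proj i : Plane →L[ℝ] ℝ).comp_memLp' hg

/-- Green's formula for a field whose components have weak gradients and a function in `H¹₀(D)`. -/
theorem IsH10.integral_inner_grad {D : Set Plane} {f : Plane → ℝ} {g w : Plane → Plane}
    {G : Fin 2 → Plane → Plane} (h : IsH10 D f g)
    (hw : MemLp w 2 (volume.restrict D)) (hG : ∀ i, MemLp (G i) 2 (volume.restrict D))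
    (hwG : ∀ i, HasWeakGrad D (fun x => w x i) (G i)) :
    ∫ x in D, inner ℝ (w x) (g x) = - ∫ x in D, (∑ i, G i x i) * f x := by
  obtain ⟨hf, hg, φ, hφ, l1, l2⟩ := h
  have hd : MemLp (fun x => ∑ i, G i x i) 2 (volume.restrict D) :=
    memLp_finsetSum _ fun i _ => memLp_apply (hG i) i
  have t1 := tendsto_integral_inner_of_tendsto_eLpNorm hd (fun n => (hφ n).memLp) hf l1
  have t2 := tendsto_integral_inner_of_tendsto_eLpNorm hw (fun n => (hφ n).memLp_gradient) hg l2
  have e : ∀ n, ∫ x in D, inner ℝ (w x) (gradient (φ n) x)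
      = - ∫ x in D, inner ℝ (∑ i, G i x i) (φ n x) := by
    intro n
    simp only [Plane.inner_eq_sum]
    have i1 : ∀ i, Integrable (fun x => w x i * gradient (φ n) x i) (volume.restrict D) := fun i =>
      (memLp_apply hw i).integrable_mul (memLp_apply (hφ n).memLp_gradient i)
    have i2 : ∀ i, Integrable (fun x => φ n x * G i x i) (volume.restrict D) := fun i =>
      (hφ n).memLp.integrable_mul (memLp_apply (hG i) i)
    rw [integral_finsetSum _ fun i _ => i1 i]
    simp only [(hwG _).integral_mul_apply (hφ n), Finset.sum_neg_distrib]
    rw [← integral_finsetSum _ fun i _ => i2 i]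
    simp [mul_add]
  have key := tendsto_nhds_unique (t2.congr e) t1.neg
  rw [key]
  simp [mul_comm]

/-! ### Square integrable functions on the product of the parameter space and the domain -/

section ProductSpace

variable {N : ℕ} {μ : Measure (Param N)} {D : Set Plane}

/-- `b` belongs to `L^∞(ℝ^N; W^{1,∞}(D))` with norm at most `C`, and `gb` is its spatial
gradient. -/
structure IsMultiplier (μ : Measure (Param N)) (D : Set Plane) (b : Param N × Plane → ℝ)
    (gb : Param N × Plane → Plane) (C : ℝ) : Prop where
  meas : AEStronglyMeasurable b (prodMeasure μ D)
  meas_grad : AEStronglyMeasurable gb (prodMeasure μ D)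
  nonneg : 0 ≤ C
  le : ∀ᵐ z ∂(prodMeasure μ D), ‖b z‖ ≤ C
  le_grad : ∀ᵐ z ∂(prodMeasure μ D), ‖gb z‖ ≤ C
  grad : ∀ᵐ y ∂μ, HasWeakGrad D (fun x => b (y, x)) (fun x => gb (y, x))

theorem IsMultiplier.isW1Infty {b : Param N × Plane → ℝ} {gb : Param N × Plane → Plane} {C : ℝ}
    (h : IsMultiplier μ D b gb C) :
    ∀ᵐ y ∂μ, IsW1Infty D (fun x => b (y, x)) (fun x => gb (y, x)) C := by
  filter_upwards [h.grad, Measure.ae_ae_of_ae_prod h.le, Measure.ae_ae_of_ae_prod h.le_grad]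
    with y h1 h2 h3
  exact ⟨h1, h.nonneg, h2, h3⟩

/-- The divergence of `b w` is `b div w + ∇b · w`. -/
def mulDiv (b : Param N × Plane → ℝ) (gb : Param N × Plane → Plane) (w : VectorL2 μ D)
    (G : Fin 2 → VectorL2 μ D) (z : Param N × Plane) : ℝ :=
  b z * divergence G z + inner ℝ (gb z) (w z)

theorem memLp_divergence (G : Fin 2 → VectorL2 μ D) : MemLp (divergence G) 2 (prodMeasure μ D) :=
  memLp_finsetSum _ fun i _ => memLp_apply (Lp.memLp (G i)) i

/-- The converse of the slicing of null sets needs measurability. The set where `f` and `g` agree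
need not be measurable, but it can be replaced by the set where measurable representatives agree. -/
theorem ae_eq_prod_of_ae_ae_eq {E : Type*} [NormedAddCommGroup E] {f g : Param N × Plane → E}
    (hf : AEStronglyMeasurable f (prodMeasure μ D)) (hg : AEStronglyMeasurable g (prodMeasure μ D))
    (h : ∀ᵐ y ∂μ, ∀ᵐ x ∂(volume.restrict D), f (y, x) = g (y, x)) :
    f =ᵐ[prodMeasure μ D] g := by
  have hm : MeasurableSet {z | hf.mk f z = hg.mk g z} :=
    StronglyMeasurable.measurableSet_eq_fun hf.stronglyMeasurable_mk hg.stronglyMeasurable_mk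
  have h1 : ∀ᵐ z ∂(prodMeasure μ D), hf.mk f z = hg.mk g z := by
    refine (Measure.ae_prod_iff_ae_ae hm).2 ?_
    filter_upwards [h, Measure.ae_ae_of_ae_prod hf.ae_eq_mk, Measure.ae_ae_of_ae_prod hg.ae_eq_mk]
      with y h1 h2 h3
    filter_upwards [h1, h2, h3] with x h1 h2 h3
    rw [← h2, ← h3, h1]
  filter_upwards [h1, hf.ae_eq_mk, hg.ae_eq_mk] with z h1 h2 h3
  rw [h2, h3, h1]

theorem MemLp.ae_slice [IsProbabilityMeasure μ] {E : Type*} [NormedAddCommGroup E]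
    {f : Param N × Plane → E}
    (hf : MemLp f 2 (prodMeasure μ D)) :
    ∀ᵐ y ∂μ, MemLp (fun x => f (y, x)) 2 (volume.restrict D) := by
  filter_upwards [hf.1.prodMk_left, hf.integrable_norm_pow (by norm_num) |>.prod_right_ae]
    with y h1 h2
  rw [← integrable_norm_rpow_iff h1 (by norm_num) (by norm_num)]
  simpa using h2

theorem integrable_inner_of_memLp {α E : Type*} [MeasurableSpace α] {ν : Measure α}
    [NormedAddCommGroup E] [InnerProductSpace ℝ E] {f g : α → E} (hf : MemLp f 2 ν)
    (hg : MemLp g 2 ν) : Integrable (fun z => (inner ℝ (f z) (g z) : ℝ)) ν := by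
  refine (L2.integrable_inner (𝕜 := ℝ) (hf.toLp f) (hg.toLp g)).congr ?_
  filter_upwards [hf.coeFn_toLp, hg.coeFn_toLp] with z h1 h2
  rw [h1, h2]

theorem inner_eq_integral {α E : Type*} [MeasurableSpace α] {ν : Measure α}
    [NormedAddCommGroup E] [InnerProductSpace ℝ E] {F G : Lp E 2 ν} {f g : α → E}
    (hf : F =ᵐ[ν] f) (hg : G =ᵐ[ν] g) : inner ℝ F G = ∫ z, inner ℝ (f z) (g z) ∂ν := by
  rw [L2.inner_def]
  refine integral_congr_ae ?_
  filter_upwards [hf, hg] with z h1 h2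
  rw [h1, h2]

theorem expInnerVec_eq_integral [IsProbabilityMeasure μ] {f g : Param N × Plane → Plane}
    (hf : MemLp f 2 (prodMeasure μ D))
    (hg : MemLp g 2 (prodMeasure μ D)) :
    expInnerVec μ D f g = ∫ z, inner ℝ (f z) (g z) ∂(prodMeasure μ D) :=
  (integral_prod _ (integrable_inner_of_memLp hf hg)).symm

theorem expInner_eq_integral [IsProbabilityMeasure μ] {f g : Param N × Plane → ℝ}
    (hf : MemLp f 2 (prodMeasure μ D))
    (hg : MemLp g 2 (prodMeasure μ D)) :
    expInner μ D f g = ∫ z, f z * g z ∂(prodMeasure μ D) :=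
  (integral_prod _ (hf.integrable_mul hg)).symm

theorem meanSq_eq_norm_sq [IsProbabilityMeasure μ] {E : Type*} [NormedAddCommGroup E]
    [InnerProductSpace ℝ E]
    (F : Lp E 2 (prodMeasure μ D)) {f : Param N × Plane → E} (hf : F =ᵐ[prodMeasure μ D] f) :
    meanSq μ D f = ‖F‖ ^ 2 := by
  have hm : MemLp f 2 (prodMeasure μ D) := (Lp.memLp F).ae_eq hf
  rw [← real_inner_self_eq_norm_sq, inner_eq_integral hf hf]
  simp only [real_inner_self_eq_norm_sq]
  exact (integral_prod (fun z => ‖f z‖ ^ 2) (hm.integrable_norm_pow (by norm_num))).symm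

/-- A relation that holds for each test function, in the mean over each set of parameters, holds for
almost every parameter and all test functions. The exceptional sets of countably many test functions
suffice, because the test functions form a separable subset of `H¹`. -/
theorem ae_forall_isTest [IsProbabilityMeasure μ] {f : Param N × Plane → ℝ}
    {g : Param N × Plane → Plane}
    (hf : MemLp f 2 (prodMeasure μ D)) (hg : MemLp g 2 (prodMeasure μ D))
    (h : ∀ A : Set (Param N), MeasurableSet A → ∀ φ : Plane → ℝ, IsTest D φ →
      ∫ y in A, (∫ x in D, (f (y, x) * φ x + inner ℝ (g (y, x)) (gradient φ x))) ∂μ = 0) :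
    ∀ᵐ y ∂μ, ∀ φ : Plane → ℝ, IsTest D φ →
      ∫ x in D, (f (y, x) * φ x + inner ℝ (g (y, x)) (gradient φ x)) = 0 := by
  have : Fact ((2 : ℝ≥0∞) ≠ ⊤) := ⟨by norm_num⟩
  have hsep₁ : SecondCountableTopology (Lp ℝ 2 (volume.restrict D)) := inferInstance
  have hsep₂ : SecondCountableTopology (Lp Plane 2 (volume.restrict D)) := inferInstance
  let ι : {φ : Plane → ℝ // IsTest D φ} →
      Lp ℝ 2 (volume.restrict D) × Lp Plane 2 (volume.restrict D) := fun φ =>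
    (φ.2.memLp.toLp φ.1, φ.2.memLp_gradient.toLp (gradient φ.1))
  obtain ⟨t, hts, htc, hst⟩ :=
    (TopologicalSpace.IsSeparable.of_separableSpace (range ι)).exists_countable_dense_subset
  have hone : ∀ φ : {φ : Plane → ℝ // IsTest D φ}, ∀ᵐ y ∂μ,
      ∫ x in D, (f (y, x) * φ.1 x + inner ℝ (g (y, x)) (gradient φ.1 x)) = 0 := by
    intro φ
    have e1 : MemLp (fun z : Param N × Plane => φ.1 z.2) 2 (prodMeasure μ D) :=
      φ.2.memLp.comp_snd μ
    have e2 : MemLp (fun z : Param N × Plane => gradient φ.1 z.2) 2 (prodMeasure μ D) :=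
      φ.2.memLp_gradient.comp_snd μ
    have hi : Integrable (fun z : Param N × Plane =>
        f z * φ.1 z.2 + inner ℝ (g z) (gradient φ.1 z.2)) (prodMeasure μ D) :=
      (hf.integrable_mul e1).add (integrable_inner_of_memLp hg e2)
    exact hi.integral_prod_left.ae_eq_zero_of_forall_setIntegral_eq_zero
      fun A hA _ => h A hA φ.1 φ.2
  have hcount : ∀ᵐ y ∂μ, ∀ ψ ∈ t, ∃ φ : {φ : Plane → ℝ // IsTest D φ}, ι φ = ψ ∧
      ∫ x in D, (f (y, x) * φ.1 x + inner ℝ (g (y, x)) (gradient φ.1 x)) = 0 := by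
    rw [ae_ball_iff htc]
    intro ψ hψ
    obtain ⟨φ, hφ⟩ := hts hψ
    filter_upwards [hone φ] with y hy
    exact ⟨φ, hφ, hy⟩
  filter_upwards [hcount, MemLp.ae_slice hf, MemLp.ae_slice hg] with y hy hfy hgy
  have key : ∀ φ : {φ : Plane → ℝ // IsTest D φ},
      ∫ x in D, (f (y, x) * φ.1 x + inner ℝ (g (y, x)) (gradient φ.1 x))
        = inner ℝ (hfy.toLp _) (ι φ).1 + inner ℝ (hgy.toLp _) (ι φ).2 := by
    intro φ
    rw [inner_eq_integral hfy.coeFn_toLp φ.2.memLp.coeFn_toLp,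
      inner_eq_integral hgy.coeFn_toLp φ.2.memLp_gradient.coeFn_toLp,
      ← integral_add (integrable_inner_of_memLp hfy φ.2.memLp)
        (integrable_inner_of_memLp hgy φ.2.memLp_gradient)]
    simp [mul_comm]
  have hclosed : IsClosed {ψ : Lp ℝ 2 (volume.restrict D) × Lp Plane 2 (volume.restrict D) |
      inner ℝ (hfy.toLp _) ψ.1 + inner ℝ (hgy.toLp _) ψ.2 = (0 : ℝ)} :=
    isClosed_eq ((continuous_const.inner continuous_fst).add
      (continuous_const.inner continuous_snd)) continuous_const
  have hsub : t ⊆ {ψ : Lp ℝ 2 (volume.restrict D) × Lp Plane 2 (volume.restrict D) |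
      inner ℝ (hfy.toLp _) ψ.1 + inner ℝ (hgy.toLp _) ψ.2 = (0 : ℝ)} := by
    intro ψ hψ
    obtain ⟨φ, rfl, h0⟩ := hy ψ hψ
    exact (key φ).symm.trans h0
  intro φ hφ
  rw [key ⟨φ, hφ⟩]
  exact closure_minimal hsub hclosed (hst ⟨⟨φ, hφ⟩, rfl⟩)

/-! ### Products with bounded coefficients -/

theorem memLp_smul_of_bound {α E : Type*} [MeasurableSpace α] {ν : Measure α}
    [NormedAddCommGroup E] [NormedSpace ℝ E] {b : α → ℝ} {f : α → E} {C : ℝ}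
    (hb : AEStronglyMeasurable b ν) (hbC : ∀ᵐ z ∂ν, ‖b z‖ ≤ C) (hf : MemLp f 2 ν) :
    MemLp (fun z => b z • f z) 2 ν := by
  refine hf.of_le_mul (c := C) (hb.smul hf.1) (hbC.mono fun z hz => ?_)
  rw [norm_smul]
  exact mul_le_mul_of_nonneg_right hz (norm_nonneg _)

theorem memLp_smul_of_bound_right {α E : Type*} [MeasurableSpace α] {ν : Measure α}
    [NormedAddCommGroup E] [NormedSpace ℝ E] {b : α → E} {f : α → ℝ} {C : ℝ}
    (hb : AEStronglyMeasurable b ν) (hbC : ∀ᵐ z ∂ν, ‖b z‖ ≤ C) (hf : MemLp f 2 ν) :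
    MemLp (fun z => f z • b z) 2 ν := by
  refine hf.of_le_mul (c := C) (hf.1.smul hb) (hbC.mono fun z hz => ?_)
  rw [norm_smul, mul_comm]
  exact mul_le_mul_of_nonneg_right hz (norm_nonneg _)

/-- Multiplication by `b` maps `L²(ℝ^N; H¹(D))²` to itself, with the expected divergence. -/
theorem IsMultiplier.exists_mul (hD : IsOpen D) {b : Param N × Plane → ℝ}
    {gb : Param N × Plane → Plane} {C : ℝ} (h : IsMultiplier μ D b gb C) {w : VectorL2 μ D}
    {G : Fin 2 → VectorL2 μ D} (hw : HasSpatialJacobian w G) :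
    ∃ (w' : VectorL2 μ D) (G' : Fin 2 → VectorL2 μ D), HasSpatialJacobian w' G' ∧
      (w' =ᵐ[prodMeasure μ D] fun z => b z • w z) ∧
      (divergence G' =ᵐ[prodMeasure μ D] mulDiv b gb w G) := by
  have m1 : MemLp (fun z => b z • w z) 2 (prodMeasure μ D) :=
    memLp_smul_of_bound h.meas h.le (Lp.memLp w)
  have m2 : ∀ i, MemLp (fun z => b z • G i z + w z i • gb z) 2 (prodMeasure μ D) := fun i =>
    (memLp_smul_of_bound h.meas h.le (Lp.memLp (G i))).add
      (memLp_smul_of_bound_right h.meas_grad h.le_grad (memLp_apply (Lp.memLp w) i))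
  refine ⟨m1.toLp _, fun i => (m2 i).toLp _, fun i => ?_, m1.coeFn_toLp, ?_⟩
  · filter_upwards [h.isW1Infty, hw i, Measure.ae_ae_of_ae_prod m1.coeFn_toLp,
      Measure.ae_ae_of_ae_prod (m2 i).coeFn_toLp] with y h1 h2 h3 h4
    refine (h1.mul hD h2).congr hD ?_ ?_
    · filter_upwards [h3] with x hx
      rw [hx]
      simp
    · filter_upwards [h4] with x hx
      rw [hx]
  · have h1 : ∀ᵐ z ∂(prodMeasure μ D), ∀ i, (m2 i).toLp _ z = b z • G i z + w z i • gb z :=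
      ae_all_iff.2 fun i => (m2 i).coeFn_toLp
    filter_upwards [h1] with z hz
    simp only [divergence, mulDiv, hz, Plane.inner_eq_sum, PiLp.add_apply, PiLp.smul_apply,
      smul_eq_mul, Fin.sum_univ_two]
    ring

theorem IsMultiplier.memLp_mulDiv {b : Param N × Plane → ℝ}
    {gb : Param N × Plane → Plane} {C : ℝ} (h : IsMultiplier μ D b gb C) (w : VectorL2 μ D)
    (G : Fin 2 → VectorL2 μ D) : MemLp (mulDiv b gb w G) 2 (prodMeasure μ D) := by
  refine (memLp_smul_of_bound h.meas h.le (memLp_divergence G)).add ?_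
  refine (Lp.memLp w).of_le_mul (c := C) (h.meas_grad.inner (Lp.aestronglyMeasurable w))
    (h.le_grad.mono fun z hz => ?_)
  exact (norm_inner_le_norm _ _).trans (mul_le_mul_of_nonneg_right hz (norm_nonneg _))

end ProductSpace

/-! ### Admissible coefficients -/

section Coefficients

variable {N : ℕ} {μ : Measure (Param N)} {D : Set Plane}

theorem IsCoefficient.norm_le {amin amax : ℝ} {a : Param N × Plane → ℝ}
    {ga : Param N × Plane → Plane} (h : IsCoefficient μ D amin amax a ga) :
    ∀ᵐ z ∂(prodMeasure μ D), ‖a z‖ ≤ √amax := by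
  filter_upwards [h.upper.2.1] with z hz
  exact Real.abs_le_sqrt ((le_abs_self _).trans hz)

theorem IsCoefficient.le_norm {amin amax : ℝ} {a : Param N × Plane → ℝ}
    {ga : Param N × Plane → Plane} (h : IsCoefficient μ D amin amax a ga) :
    ∀ᵐ z ∂(prodMeasure μ D), √amin ≤ ‖a z‖ := by
  filter_upwards [h.lower] with z hz
  rw [Real.norm_eq_abs, ← Real.sqrt_sq_eq_abs]
  exact Real.sqrt_le_sqrt hz

theorem IsCoefficient.grad_sq (hD : IsOpen D) {amin amax : ℝ} {a : Param N × Plane → ℝ}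
    {ga : Param N × Plane → Plane} (h : IsCoefficient μ D amin amax a ga) :
    ∀ᵐ y ∂μ, HasWeakGrad D (fun x => a (y, x) ^ 2) (fun x => (2 * a (y, x)) • ga (y, x)) := by
  filter_upwards [h.grad, Measure.ae_ae_of_ae_prod h.norm_le] with y h1 h2
  exact h1.sq hD (Real.sqrt_nonneg _) h2

theorem IsCoefficient.norm_grad_sq_le (hD : IsOpen D) {amin amax : ℝ} {a : Param N × Plane → ℝ}
    {ga : Param N × Plane → Plane} (h : IsCoefficient μ D amin amax a ga) :
    ∀ᵐ z ∂(prodMeasure μ D), ‖(2 * a z) • ga z‖ ≤ amax := by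
  obtain ⟨-, -, g, hgm, hg, hgle⟩ := h.upper
  have h1 : g =ᵐ[prodMeasure μ D] fun z => (2 * a z) • ga z := by
    refine ae_eq_prod_of_ae_ae_eq hgm ((h.meas.const_mul 2).smul h.meas_grad) ?_
    filter_upwards [hg, h.grad_sq hD] with y h1 h2
    exact h1.unique hD h2
  filter_upwards [h1, hgle] with z h1 h2
  rwa [← h1]

/-- Although `∇a` is only assumed to be locally integrable, it is bounded: `2 |a| |∇a| = |∇(a²)|`,
and `|a|` is bounded below. -/
theorem IsCoefficient.norm_grad_le (hD : IsOpen D) {amin amax : ℝ} (hamin : 0 < amin)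
    {a : Param N × Plane → ℝ} {ga : Param N × Plane → Plane}
    (h : IsCoefficient μ D amin amax a ga) :
    ∀ᵐ z ∂(prodMeasure μ D), ‖ga z‖ ≤ amax / (2 * √amin) := by
  have hs := Real.sqrt_pos.2 hamin
  filter_upwards [h.norm_grad_sq_le hD, h.le_norm] with z h1 h2
  rw [norm_smul, norm_mul, Real.norm_two] at h1
  rw [le_div_iff₀ (by positivity), mul_comm]
  exact (mul_le_mul_of_nonneg_right (by linarith) (norm_nonneg _)).trans h1

theorem IsCoefficient.isMultiplier (hD : IsOpen D) {amin amax : ℝ} (hamin : 0 < amin)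
    {a : Param N × Plane → ℝ} {ga : Param N × Plane → Plane}
    (h : IsCoefficient μ D amin amax a ga) :
    IsMultiplier μ D a ga (max (√amax) (amax / (2 * √amin))) where
  meas := h.meas
  meas_grad := h.meas_grad
  nonneg := (Real.sqrt_nonneg _).trans (le_max_left _ _)
  le := h.norm_le.mono fun _ hz => hz.trans (le_max_left _ _)
  le_grad := (h.norm_grad_le hD hamin).mono fun _ hz => hz.trans (le_max_right _ _)
  grad := h.grad

theorem IsCoefficient.isMultiplier_inv (hD : IsOpen D) {amin amax : ℝ} (hamin : 0 < amin)
    (hamax : amin ≤ amax) {a : Param N × Plane → ℝ} {ga : Param N × Plane → Plane}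
    (h : IsCoefficient μ D amin amax a ga) :
    IsMultiplier μ D (fun z => (a z)⁻¹) (fun z => -((a z ^ 2)⁻¹ • ga z))
      (max ((√amin)⁻¹) (amin⁻¹ * (amax / (2 * √amin)))) where
  meas := h.meas.inv₀
  meas_grad := ((h.meas.pow 2).inv₀.smul h.meas_grad).neg
  nonneg := (inv_nonneg.2 (Real.sqrt_nonneg _)).trans (le_max_left _ _)
  le := by
    filter_upwards [h.le_norm] with z hz
    rw [norm_inv]
    exact (inv_anti₀ (Real.sqrt_pos.2 hamin) hz).trans (le_max_left _ _)
  le_grad := by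
    filter_upwards [h.lower, h.norm_grad_le hD hamin] with z h1 h2
    rw [norm_neg, norm_smul, norm_inv, Real.norm_of_nonneg (sq_nonneg _)]
    exact (mul_le_mul (inv_anti₀ hamin h1) h2 (norm_nonneg _)
      (inv_nonneg.2 hamin.le)).trans (le_max_right _ _)
  grad := by
    filter_upwards [h.grad, h.grad_sq hD, Measure.ae_ae_of_ae_prod h.lower,
      Measure.ae_ae_of_ae_prod h.upper.2.1, Measure.ae_ae_of_ae_prod (h.norm_grad_sq_le hD)]
      with y h1 h2 h3 h4 h5
    exact h1.inv hD hamin h3 ⟨h2, hamin.le.trans hamax, h4, h5⟩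

/-- The factor in the bounds for `a - a'` and `∇a - ∇a'` in terms of `a² - a'²`. -/
def coeffConst (amin amin' amax' : ℝ) : ℝ :=
  max ((√amin)⁻¹) ((2 * √amin)⁻¹ * (1 + amax' / (√amin * √amin')))

theorem coeffConst_pos {amin amin' amax' : ℝ} (hamin : 0 < amin) :
    0 < coeffConst amin amin' amax' :=
  (inv_pos.2 (Real.sqrt_pos.2 hamin)).trans_le (le_max_left _ _)

theorem abs_sub_mul_le_of_mul_pos {r s m : ℝ} (hrs : 0 < r * s) (hr : m ≤ |r|) :
    |r - s| * m ≤ |r ^ 2 - s ^ 2| := by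
  have h1 : |r ^ 2 - s ^ 2| = |r - s| * (|r| + |s|) := by
    rw [← abs_add_eq_add_abs_iff r s |>.2 ?_, ← abs_mul]
    · ring_nf
    · rcases pos_and_pos_or_neg_and_neg_of_mul_pos hrs with h | h
      · exact Or.inl ⟨h.1.le, h.2.le⟩
      · exact Or.inr ⟨h.1.le, h.2.le⟩
  rw [h1]
  exact mul_le_mul_of_nonneg_left (by linarith [abs_nonneg s]) (abs_nonneg _)

/-- Since the coefficients have the same sign, `|a + a'| = |a| + |a'|` is bounded below, so that
`a - a'` and its gradient are controlled by `a² - a'²`. -/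
theorem IsCoefficient.norm_sub_le (hD : IsOpen D) {amin amax amin' amax' ε : ℝ} (hamin : 0 < amin)
    (hamin' : 0 < amin') {a a' : Param N × Plane → ℝ} {ga ga' : Param N × Plane → Plane}
    (h : IsCoefficient μ D amin amax a ga) (h' : IsCoefficient μ D amin' amax' a' ga')
    (hpos : ∀ᵐ z ∂(prodMeasure μ D), 0 < a z * a' z)
    (hε : LinftyW1inftyNormLE μ D (fun z => a z ^ 2 - a' z ^ 2) ε) :
    ∀ᵐ z ∂(prodMeasure μ D), ‖a z - a' z‖ ≤ coeffConst amin amin' amax' * ε ∧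
      ‖ga z - ga' z‖ ≤ coeffConst amin amin' amax' * ε := by
  have hs := Real.sqrt_pos.2 hamin
  have hs' := Real.sqrt_pos.2 hamin'
  obtain ⟨-, hle, g, hgm, hg, hgle⟩ := hε
  have hgeq : g =ᵐ[prodMeasure μ D] fun z => (2 * a z) • ga z - (2 * a' z) • ga' z := by
    refine ae_eq_prod_of_ae_ae_eq hgm (((h.meas.const_mul 2).smul h.meas_grad).sub
      ((h'.meas.const_mul 2).smul h'.meas_grad)) ?_
    filter_upwards [hg, h.grad_sq hD, h'.grad_sq hD] with y h1 h2 h3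
    exact h1.unique hD (h2.sub h3)
  filter_upwards [hgeq, hgle, hle, hpos, h.le_norm, h'.norm_grad_le hD hamin'] with
    z h1 h2 h3 h4 h5 h6
  rw [h1] at h2
  have hε0 : 0 ≤ ε := (norm_nonneg _).trans h2
  have e1 : ‖a z - a' z‖ ≤ (√amin)⁻¹ * ε := by
    rw [inv_mul_eq_div, le_div_iff₀ hs]
    exact (abs_sub_mul_le_of_mul_pos h4 h5).trans h3
  refine ⟨e1.trans (mul_le_mul_of_nonneg_right (le_max_left _ _) hε0), ?_⟩
  refine le_trans ?_ (mul_le_mul_of_nonneg_right (le_max_right _ _) hε0)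
  have e2 : (2 * a z) • (ga z - ga' z)
      = ((2 * a z) • ga z - (2 * a' z) • ga' z) - (2 * (a z - a' z)) • ga' z := by module
  have e3 : 2 * √amin * ‖ga z - ga' z‖ ≤ ε + 2 * ((√amin)⁻¹ * ε) * (amax' / (2 * √amin')) := by
    calc 2 * √amin * ‖ga z - ga' z‖ ≤ 2 * ‖a z‖ * ‖ga z - ga' z‖ :=
          mul_le_mul_of_nonneg_right (by linarith) (norm_nonneg _)
      _ = ‖(2 * a z) • (ga z - ga' z)‖ := by rw [norm_smul, norm_mul, Real.norm_two]
      _ ≤ ε + 2 * ‖a z - a' z‖ * ‖ga' z‖ := by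
          rw [e2]
          refine (_root_.norm_sub_le _ _).trans (add_le_add h2 ?_)
          rw [norm_smul, norm_mul, Real.norm_two]
      _ ≤ _ := by
          refine add_le_add le_rfl (mul_le_mul (by linarith) h6 (norm_nonneg _) (by positivity))
  calc ‖ga z - ga' z‖ = (2 * √amin)⁻¹ * (2 * √amin * ‖ga z - ga' z‖) := by field_simp
    _ ≤ (2 * √amin)⁻¹ * (ε + 2 * ((√amin)⁻¹ * ε) * (amax' / (2 * √amin'))) :=
        mul_le_mul_of_nonneg_left e3 (by positivity)
    _ = _ := by field_simp

end Coefficients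

/-! ### Testing with products of test functions and indicator functions of parameter sets -/

section Testing

variable {N : ℕ} {μ : Measure (Param N)} {D : Set Plane}

/-- The indicator function of a set of parameters, as a function on the product space. -/
def paramIndicator (A : Set (Param N)) (z : Param N × Plane) : ℝ :=
  A.indicator (fun _ => (1 : ℝ)) z.1

theorem aestronglyMeasurable_paramIndicator {A : Set (Param N)} (hA : MeasurableSet A) :
    AEStronglyMeasurable (paramIndicator A) (prodMeasure μ D) :=
  ((measurable_const.indicator hA).comp measurable_fst).aestronglyMeasurable

theorem norm_paramIndicator_le (A : Set (Param N)) (z : Param N × Plane) :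
    ‖paramIndicator A z‖ ≤ 1 := by
  unfold paramIndicator
  by_cases h : z.1 ∈ A <;> simp [h]

theorem setIntegral_param [IsProbabilityMeasure μ] {A : Set (Param N)} (hA : MeasurableSet A)
    {h : Param N × Plane → ℝ}
    (hh : Integrable h (prodMeasure μ D)) :
    ∫ y in A, (∫ x in D, h (y, x)) ∂μ = ∫ z, paramIndicator A z * h z ∂(prodMeasure μ D) := by
  have hi : Integrable (fun z => paramIndicator A z * h z) (prodMeasure μ D) :=
    hh.bdd_mul (aestronglyMeasurable_paramIndicator hA)
      (Eventually.of_forall (norm_paramIndicator_le A))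
  rw [← integral_indicator hA, integral_prod _ hi]
  refine integral_congr_ae (Eventually.of_forall fun y => ?_)
  by_cases hy : y ∈ A <;> simp [paramIndicator, hy]

theorem IsTest.memLp_param [IsProbabilityMeasure μ] {φ : Plane → ℝ} (hφ : IsTest D φ)
    {A : Set (Param N)} (hA : MeasurableSet A) :
    MemLp (fun z : Param N × Plane => paramIndicator A z * φ z.2) 2 (prodMeasure μ D) :=
  memLp_smul_of_bound (aestronglyMeasurable_paramIndicator hA)
    (Eventually.of_forall (norm_paramIndicator_le A)) (hφ.memLp.comp_snd μ)

theorem IsTest.memLp_param_gradient [IsProbabilityMeasure μ] {φ : Plane → ℝ} (hφ : IsTest D φ)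
    {A : Set (Param N)} (hA : MeasurableSet A) :
    MemLp (fun z : Param N × Plane => paramIndicator A z • gradient φ z.2) 2 (prodMeasure μ D) :=
  memLp_smul_of_bound (aestronglyMeasurable_paramIndicator hA)
    (Eventually.of_forall (norm_paramIndicator_le A)) (hφ.memLp_gradient.comp_snd μ)

/-- `toL2Hneg` as a continuous linear map. -/
def toL2HnegL : ScalarL2 μ D →L[ℝ] L2Hneg μ D :=
  ((ContinuousLinearMap.compL ℝ (L2H10 μ D) (ScalarL2 μ D) ℝ).flip L2H10.toL2).comp
    (innerSL ℝ)

theorem toL2HnegL_apply (f : ScalarL2 μ D) : toL2HnegL f = toL2Hneg f := rfl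

/-- The embedding is injective, because the functions `1_A φ` belong to `L²(ℝ^N; H¹₀(D))` for all
sets `A` of parameters and test functions `φ`. -/
theorem toL2HnegL_injective [IsProbabilityMeasure μ] (hD : IsOpen D) :
    Function.Injective (toL2HnegL : ScalarL2 μ D →L[ℝ] L2Hneg μ D) := by
  rw [injective_iff_map_eq_zero]
  intro f hf
  have h1 : ∀ᵐ y ∂μ, ∀ φ : Plane → ℝ, IsTest D φ → ∫ x in D, (f (y, x) * φ x
      + inner ℝ ((0 : Plane)) (gradient φ x)) = 0 := by
    refine ae_forall_isTest (g := fun _ => (0 : Plane)) (Lp.memLp f) MemLp.zero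
      fun A hA φ hφ => ?_
    let p : L2H10 μ D := ⟨WithLp.toLp 2 ((hφ.memLp_param hA).toLp _,
      (hφ.memLp_param_gradient hA).toLp _), by
        change ∀ᵐ y ∂μ, _
        filter_upwards [Measure.ae_ae_of_ae_prod (hφ.memLp_param (μ := μ) hA).coeFn_toLp,
          Measure.ae_ae_of_ae_prod (hφ.memLp_param_gradient (μ := μ) hA).coeFn_toLp] with y h1 h2
        exact (hφ.isH10.smul (A.indicator (fun _ => (1 : ℝ)) y)).congr (EventuallyEq.symm h1)
          (EventuallyEq.symm h2)⟩
    have h2 : toL2HnegL f p = 0 := by rw [hf]; rfl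
    have h3 : toL2HnegL f p = inner ℝ f ((hφ.memLp_param hA).toLp _) := rfl
    rw [h3, inner_eq_integral (EventuallyEq.refl _ _) (hφ.memLp_param hA).coeFn_toLp] at h2
    simp only [inner_zero_left, add_zero]
    have hi : Integrable (fun z => f z * φ z.2) (prodMeasure μ D) :=
      (Lp.memLp f).integrable_mul (hφ.memLp.comp_snd μ)
    rw [setIntegral_param hA hi, ← h2]
    refine integral_congr_ae (Eventually.of_forall fun z => ?_)
    simp only [RCLike.inner_apply, conj_trivial]
    ring
  rw [Lp.eq_zero_iff_ae_eq_zero]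
  refine ae_eq_prod_of_ae_ae_eq (Lp.aestronglyMeasurable f) aestronglyMeasurable_const ?_
  filter_upwards [h1, MemLp.ae_slice (Lp.memLp f)] with y hy hfy
  rw [ae_restrict_iff' hD.measurableSet]
  have hl : LocallyIntegrableOn (fun x => f (y, x)) D volume :=
    locallyIntegrableOn_of_locallyIntegrable_restrict (hfy.locallyIntegrable (by norm_num))
  refine hD.ae_eq_zero_of_integral_contDiff_smul_eq_zero hl fun φ h2 h3 h4 => ?_
  rw [← hy φ ⟨h2, h3, h4⟩]
  simp only [inner_zero_left, add_zero]
  rw [setIntegral_eq_integral_of_forall_compl_eq_zero]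
  · simp [mul_comm]
  · intro x hx
    rw [image_eq_zero_of_notMem_tsupport fun hx' => hx (h4 hx'), mul_zero]

/-- A function is weakly differentiable if it satisfies the integration by parts formula with all
fields in `L²(ℝ^N; H¹(D))²`. The fields `1_A φ eᵢ` suffice, where `A` is a set of parameters, `φ` is
a test function and `eᵢ` is a unit vector. -/
theorem hasSpatialGrad_of_forall [IsProbabilityMeasure μ] (hD : IsOpen D) {v : ScalarL2 μ D}
    {g : VectorL2 μ D}
    (h : ∀ (w : VectorL2 μ D) (G : Fin 2 → VectorL2 μ D), HasSpatialJacobian w G →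
      inner ℝ g w + ∫ z, v z * divergence G z ∂(prodMeasure μ D) = 0) :
    HasSpatialGrad v g := by
  have h1 : ∀ i : Fin 2, ∀ᵐ y ∂μ, ∀ φ : Plane → ℝ, IsTest D φ → ∫ x in D, (g (y, x) i * φ x
      + inner ℝ (v (y, x) • EuclideanSpace.single i (1 : ℝ)) (gradient φ x)) = 0 := by
    intro i
    have hvm : MemLp (fun z => v z • (EuclideanSpace.single i (1 : ℝ) : Plane)) 2
        (prodMeasure μ D) :=
      memLp_smul_of_bound_right (C := 1) aestronglyMeasurable_const
        (Eventually.of_forall fun z => by simp) (Lp.memLp v)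
    refine ae_forall_isTest (f := fun z => g z i)
      (g := fun z => v z • (EuclideanSpace.single i (1 : ℝ) : Plane))
      (memLp_apply (Lp.memLp g) i) hvm fun A hA φ hφ => ?_
    have mw : MemLp (fun z : Param N × Plane => (paramIndicator A z * φ z.2) •
        (EuclideanSpace.single i (1 : ℝ) : Plane)) 2 (prodMeasure μ D) :=
      memLp_smul_of_bound_right (C := 1) aestronglyMeasurable_const
        (Eventually.of_forall fun z => by simp) (hφ.memLp_param hA)
    have mG : ∀ j, MemLp (fun z : Param N × Plane =>
        (EuclideanSpace.single i (1 : ℝ) : Plane) j • (paramIndicator A z • gradient φ z.2)) 2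
        (prodMeasure μ D) := fun j =>
      (hφ.memLp_param_gradient hA).const_smul ((EuclideanSpace.single i (1 : ℝ) : Plane) j)
    have hj : HasSpatialJacobian (mw.toLp _) (fun j => (mG j).toLp _) := by
      intro j
      filter_upwards [Measure.ae_ae_of_ae_prod mw.coeFn_toLp,
        Measure.ae_ae_of_ae_prod (mG j).coeFn_toLp] with y h1 h2
      have hc := hasWeakGrad_of_contDiff (D := D) (contDiff_const.mul hφ.1 : ContDiff ℝ ∞
        fun x => ((EuclideanSpace.single i (1 : ℝ) : Plane) j
          * A.indicator (fun _ => (1 : ℝ)) y) * φ x)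
      refine hc.congr hD ?_ ?_
      · filter_upwards [h1] with x hx
        rw [hx]
        simp only [paramIndicator, PiLp.smul_apply, smul_eq_mul]
        ring
      · filter_upwards [h2] with x hx
        rw [hx, gradient_smul_fun hφ.1, mul_smul]
        rfl
    have h2 := h _ _ hj
    have hdiv : ∀ᵐ z ∂(prodMeasure μ D), divergence (fun j => (mG j).toLp _) z
        = paramIndicator A z * gradient φ z.2 i := by
      have : ∀ᵐ z ∂(prodMeasure μ D), ∀ j, (mG j).toLp _ z
          = (EuclideanSpace.single i (1 : ℝ) : Plane) j • (paramIndicator A z • gradient φ z.2) :=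
        ae_all_iff.2 fun j => (mG j).coeFn_toLp
      filter_upwards [this] with z hz
      calc _ = ∑ j, ((EuclideanSpace.single i (1 : ℝ) : Plane) j •
            (paramIndicator A z • gradient φ z.2)) j :=
            Finset.sum_congr rfl fun j _ => congrArg (fun v : Plane => v j) (hz j)
        _ = _ := by
            simp only [PiLp.smul_apply, PiLp.single_apply, smul_eq_mul, ite_mul, one_mul, zero_mul,
              Finset.sum_ite_eq', Finset.mem_univ, if_true]
    have i1 : Integrable (fun z => g z i * φ z.2) (prodMeasure μ D) :=
      (memLp_apply (Lp.memLp g) i).integrable_mul (hφ.memLp.comp_snd μ)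
    have i2 : Integrable (fun z : Param N × Plane =>
        (inner ℝ (v z • (EuclideanSpace.single i (1 : ℝ) : Plane)) (gradient φ z.2) : ℝ))
        (prodMeasure μ D) :=
      integrable_inner_of_memLp hvm (hφ.memLp_gradient.comp_snd μ)
    have hsum : Integrable (fun z : Param N × Plane => g z i * φ z.2
        + inner ℝ (v z • (EuclideanSpace.single i (1 : ℝ) : Plane)) (gradient φ z.2))
        (prodMeasure μ D) := i1.add i2
    rw [setIntegral_param hA hsum, ← h2, inner_eq_integral (EventuallyEq.refl _ _) mw.coeFn_toLp,
      ← integral_add]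
    · refine integral_congr_ae ?_
      filter_upwards [hdiv] with z hz
      rw [hz]
      simp only [inner_smul_left, inner_smul_right, conj_trivial,
        EuclideanSpace.inner_single_left, EuclideanSpace.inner_single_right]
      ring
    · exact integrable_inner_of_memLp (Lp.memLp g) mw
    · exact (Lp.memLp v).integrable_mul (memLp_divergence _)
  filter_upwards [ae_all_iff.2 h1, MemLp.ae_slice (Lp.memLp v), MemLp.ae_slice (Lp.memLp g)]
    with y hy hv hg
  have l1 : LocallyIntegrableOn (fun x => v (y, x)) D volume :=
    locallyIntegrableOn_of_locallyIntegrable_restrict (hv.locallyIntegrable (by norm_num))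
  have l2 : LocallyIntegrableOn (fun x => g (y, x)) D volume :=
    locallyIntegrableOn_of_locallyIntegrable_restrict (hg.locallyIntegrable (by norm_num))
  refine ⟨l1, l2, fun φ hφ => ?_⟩
  ext i
  rw [PiLp.neg_apply, integral_plane_apply (hφ.integrable_smul_gradient l1),
    integral_plane_apply (hφ.integrable_smul l2), eq_neg_iff_add_eq_zero, ← hy i φ hφ,
    ← integral_add]
  · refine integral_congr_ae (Eventually.of_forall fun x => ?_)
    simp only [inner_smul_left, conj_trivial, EuclideanSpace.inner_single_left, PiLp.smul_apply,
      smul_eq_mul]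
    ring
  · exact (memLp_apply (hφ.memLp_gradient) i).integrable_mul hv |>.congr
      (Eventually.of_forall fun x => by simp [mul_comm])
  · exact hφ.memLp.integrable_mul (memLp_apply hg i) |>.congr
      (Eventually.of_forall fun x => by simp)

end Testing

/-! ### The equations in `L²` -/

section Equations

variable {N : ℕ} {μ : Measure (Param N)} {D : Set Plane}

/-- The divergence of `b w`, for a field `w` that depends on time in a square integrable way. -/
theorem IsMultiplier.exists_memLp_time {τ : Measure ℝ} {b : Param N × Plane → ℝ}
    {gb : Param N × Plane → Plane} {C : ℝ} (h : IsMultiplier μ D b gb C) {q : ℝ → VectorL2 μ D}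
    {G : Fin 2 → ℝ → VectorL2 μ D} (hq : MemLp q 2 τ) (hG : ∀ i, MemLp (G i) 2 τ) :
    ∃ F : ℝ → ScalarL2 μ D, MemLp F 2 τ ∧
      ∀ t, F t =ᵐ[prodMeasure μ D] mulDiv b gb (q t) (fun i => G i t) := by
  have hb : MemLp b ⊤ (prodMeasure μ D) := memLp_top_of_bound h.meas C h.le
  have hgb : MemLp gb ⊤ (prodMeasure μ D) := memLp_top_of_bound h.meas_grad C h.le_grad
  let P : Fin 2 → VectorL2 μ D →L[ℝ] ScalarL2 μ D := fun i =>
    (EuclideanSpace.proj i : Plane →L[ℝ] ℝ).compLpL 2 (prodMeasure μ D)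
  let B : ScalarL2 μ D →L[ℝ] ScalarL2 μ D :=
    (ContinuousLinearMap.lsmul ℝ ℝ : ℝ →L[ℝ] ℝ →L[ℝ] ℝ).holderL (prodMeasure μ D) ⊤ 2 2
      (hb.toLp b)
  let Q : VectorL2 μ D →L[ℝ] ScalarL2 μ D :=
    (innerSL ℝ : Plane →L[ℝ] Plane →L[ℝ] ℝ).holderL (prodMeasure μ D) ⊤ 2 2 (hgb.toLp gb)
  refine ⟨fun t => B (∑ i, P i (G i t)) + Q (q t), ?_, fun t => ?_⟩
  · refine MemLp.add ?_ (Q.comp_memLp' hq)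
    exact B.comp_memLp' (memLp_finsetSum _ fun i _ => (P i).comp_memLp' (hG i))
  · have h1 : ∀ i, P i (G i t) =ᵐ[prodMeasure μ D] fun z => G i t z i := fun i =>
      ContinuousLinearMap.coeFn_compLpL _ _
    have h2 : B (∑ i, P i (G i t)) =ᵐ[prodMeasure μ D]
        fun z => hb.toLp b z • (∑ i, P i (G i t) : ScalarL2 μ D) z :=
      ContinuousLinearMap.coeFn_holder _ _ _
    have h3 : Q (q t) =ᵐ[prodMeasure μ D] fun z => inner ℝ (hgb.toLp gb z) (q t z) :=
      ContinuousLinearMap.coeFn_holder _ _ _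
    filter_upwards [Lp.coeFn_add (B (∑ i, P i (G i t))) (Q (q t)), ae_all_iff.2 h1, h2, h3,
      hb.coeFn_toLp, hgb.coeFn_toLp, Lp.coeFn_add (P 0 (G 0 t)) (P 1 (G 1 t))]
      with z e1 e2 e3 e4 e5 e6 e7
    rw [e1, Pi.add_apply, e3, e4, e5, e6, Fin.sum_univ_two, e7, Pi.add_apply, e2, e2]
    simp [mulDiv, divergence]

/-- The weak solutions in the form in which they are used: `F = u_tt` is square integrable, and
equals the divergence of `a q`; the equation for `q_t` is written with the divergence of `a w`. -/
structure IsStrongSolution (μ : Measure (Param N)) (D : Set Plane) (T : ℝ)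
    (a : Param N × Plane → ℝ) (ga : Param N × Plane → Plane) (ut : ℝ → ScalarL2 μ D)
    (q : ℝ → VectorL2 μ D) (F : ℝ → ScalarL2 μ D) (qt : ℝ → VectorL2 μ D)
    (G : Fin 2 → ℝ → VectorL2 μ D) : Prop where
  deriv_ut : HasTimeDeriv T ut F
  deriv_q : HasTimeDeriv T q qt
  jacobian : ∀ᵐ t ∂(volume.restrict (Ioo 0 T)), HasSpatialJacobian (q t) (fun i => G i t)
  eq_ut : ∀ t, F t =ᵐ[prodMeasure μ D] mulDiv a ga (q t) (fun i => G i t)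
  eq_q : ∀ᵐ t ∂(volume.restrict (Ioo 0 T)), ∀ (w : VectorL2 μ D) (H : Fin 2 → VectorL2 μ D),
    HasSpatialJacobian w H → ∀ h : ScalarL2 μ D, h =ᵐ[prodMeasure μ D] mulDiv a ga w H →
      inner ℝ (qt t) w + inner ℝ (ut t) h = (0 : ℝ)

/-- Testing the equation for `q_t` with `w / a` shows that `q_t / a` is the gradient of `u_t`, with
zero boundary values in a weak sense. -/
theorem inner_div_add_integral (hD : IsOpen D) {a : Param N × Plane → ℝ}
    {ga : Param N × Plane → Plane} {C C' : ℝ} (ha : IsMultiplier μ D a ga C)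
    (hinv : IsMultiplier μ D (fun z => (a z)⁻¹) (fun z => -((a z ^ 2)⁻¹ • ga z)) C')
    (ha0 : ∀ᵐ z ∂(prodMeasure μ D), a z ≠ 0)
    {v : ScalarL2 μ D} {r g : VectorL2 μ D}
    (h : ∀ (w : VectorL2 μ D) (H : Fin 2 → VectorL2 μ D), HasSpatialJacobian w H →
      ∀ h : ScalarL2 μ D, h =ᵐ[prodMeasure μ D] mulDiv a ga w H →
        inner ℝ r w + inner ℝ v h = (0 : ℝ))
    (hg : g =ᵐ[prodMeasure μ D] fun z => (a z)⁻¹ • r z)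
    {w : VectorL2 μ D} {H : Fin 2 → VectorL2 μ D} (hw : HasSpatialJacobian w H) :
    inner ℝ g w + ∫ z, v z * divergence H z ∂(prodMeasure μ D) = 0 := by
  obtain ⟨w', H', hwH, hw', hH'⟩ := hinv.exists_mul hD hw
  have h1 : mulDiv a ga w' H' =ᵐ[prodMeasure μ D] divergence H := by
    filter_upwards [hw', hH', ha0] with z e1 e2 e3
    simp only [mulDiv, e1, e2, inner_smul_left, inner_smul_right, inner_neg_left, conj_trivial]
    field_simp
    ring
  have h2 := h w' H' hwH ((ha.memLp_mulDiv w' H').toLp _) (MemLp.coeFn_toLp _)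
  rw [← h2, inner_eq_integral hg (EventuallyEq.refl _ _),
    inner_eq_integral (EventuallyEq.refl _ _) hw',
    inner_eq_integral (EventuallyEq.refl _ _) ((MemLp.coeFn_toLp _).trans h1)]
  congr 1
  · simp only [inner_smul_left, inner_smul_right, conj_trivial]
  · simp [mul_comm]

variable [IsProbabilityMeasure μ]

/-- Green's formula for `a w` and functions in `L²(ℝ^N; H¹₀(D))`. -/
theorem IsMultiplier.expInnerVec_grad (hD : IsOpen D) {b : Param N × Plane → ℝ}
    {gb : Param N × Plane → Plane} {C : ℝ} (hb : IsMultiplier μ D b gb C) {w : VectorL2 μ D}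
    {G : Fin 2 → VectorL2 μ D} (hw : HasSpatialJacobian w G) {h : ScalarL2 μ D}
    (hh : h =ᵐ[prodMeasure μ D] mulDiv b gb w G) (p : L2H10 μ D) :
    expInnerVec μ D (fun z => b z • w z) (L2H10.grad p) = - inner ℝ h (L2H10.toL2 p) := by
  obtain ⟨w', G', hwG, hw', hG'⟩ := hb.exists_mul hD hw
  have hp : ∀ᵐ y ∂μ, IsH10 D (fun x => L2H10.toL2 p (y, x)) (fun x => L2H10.grad p (y, x)) := p.2
  have hh' : h =ᵐ[prodMeasure μ D] divergence G' := hh.trans hG'.symm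
  have hi : Integrable (fun z => divergence G' z * L2H10.toL2 p z) (prodMeasure μ D) :=
    (memLp_divergence G').integrable_mul (Lp.memLp _)
  have e1 : inner ℝ h (L2H10.toL2 p)
      = ∫ y, (∫ x in D, divergence G' (y, x) * L2H10.toL2 p (y, x)) ∂μ := by
    rw [inner_eq_integral hh' (EventuallyEq.refl _ _), ← integral_prod _ hi]
    simp [mul_comm]
  rw [e1, ← integral_neg]
  refine integral_congr_ae ?_
  filter_upwards [hp, ae_all_iff.2 hwG, MemLp.ae_slice (Lp.memLp w'),
    ae_all_iff.2 fun i => MemLp.ae_slice (Lp.memLp (G' i)), Measure.ae_ae_of_ae_prod hw']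
    with y h1 h2 h3 h4 h5
  refine Eq.trans (integral_congr_ae ?_) (h1.integral_inner_grad h3 h4 h2)
  filter_upwards [h5] with x hx
  rw [hx]

theorem IsWeakSolution.exists_strong (hD : IsOpen D) {T : ℝ}
    {a : Param N × Plane → ℝ} {ga : Param N × Plane → Plane} {C : ℝ}
    (ha : IsMultiplier μ D a ga C) {u ut : ℝ → ScalarL2 μ D} {q : ℝ → VectorL2 μ D}
    (h : IsWeakSolution μ D T a ga u ut q) :
    ∃ (F : ℝ → ScalarL2 μ D) (qt : ℝ → VectorL2 μ D) (G : Fin 2 → ℝ → VectorL2 μ D),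
      IsStrongSolution μ D T a ga ut q F qt G := by
  obtain ⟨hq, G, hG, hjac⟩ := h.mem_q
  obtain ⟨utt, hutt, hequ⟩ := h.eq_u
  obtain ⟨qt, hqt, heqq⟩ := h.eq_q
  obtain ⟨F, hF, hFeq⟩ := ha.exists_memLp_time hq hG
  refine ⟨F, qt, G, ⟨hF, fun t ht => ?_⟩, hqt, hjac, hFeq, ?_⟩
  · -- `u_tt` is the functional represented by `F`, and such functionals determine the function
    have hFi : ∀ t ∈ Icc 0 T, IntervalIntegrable F volume 0 t := by
      intro t ht
      rw [intervalIntegrable_iff_integrableOn_Ioo_of_le ht.1]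
      have h1 : IntegrableOn F (Ioo 0 T) volume := hF.integrable (by norm_num)
      exact h1.mono_set (Ioo_subset_Ioo_right ht.2)
    have h1 : ∀ᵐ s ∂(volume.restrict (Ioo 0 T)), utt s = toL2HnegL (F s) := by
      filter_upwards [hequ, hjac] with s h1 h2
      ext p
      have h3 := h1 p
      rw [ha.expInnerVec_grad hD h2 (hFeq s) p] at h3
      rw [add_neg_eq_zero.1 h3]
      rfl
    apply toL2HnegL_injective hD
    rw [map_add, toL2HnegL_apply, toL2HnegL_apply,
      ← toL2HnegL.intervalIntegral_comp_comm (hFi t ht)]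
    refine (hutt.2 t ht).trans (congrArg (fun ℓ => toL2Hneg (ut 0) + ℓ) ?_)
    refine intervalIntegral.integral_congr_ae ?_
    have h2 := (ae_restrict_iff' measurableSet_Ioo).1 h1
    have h3 : ∀ᵐ s : ℝ, s ≠ t := by simp [ae_iff]
    filter_upwards [h2, h3] with s hs hst hmem
    rw [uIoc_of_le ht.1] at hmem
    exact hs ⟨hmem.1, lt_of_lt_of_le (lt_of_le_of_ne hmem.2 hst) ht.2⟩
  · filter_upwards [heqq] with t ht w H hwH h hh
    have h1 := ht w H hwH
    have m1 : MemLp (fun z => a z * ut t z) 2 (prodMeasure μ D) :=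
      memLp_smul_of_bound ha.meas ha.le (Lp.memLp (ut t))
    have m2 : MemLp (fun z => ut t z • ga z) 2 (prodMeasure μ D) :=
      memLp_smul_of_bound_right ha.meas_grad ha.le_grad (Lp.memLp (ut t))
    have i1 : Integrable (fun z => a z * ut t z * divergence H z) (prodMeasure μ D) :=
      m1.integrable_mul (memLp_divergence H)
    rw [expInnerVec_eq_integral (Lp.memLp _) (Lp.memLp _),
      expInner_eq_integral m1 (memLp_divergence H), expInnerVec_eq_integral m2 (Lp.memLp _),
      add_assoc, ← integral_add i1 (integrable_inner_of_memLp m2 (Lp.memLp w))] at h1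
    rw [← h1, inner_eq_integral (EventuallyEq.refl _ _) (EventuallyEq.refl _ _),
      inner_eq_integral (EventuallyEq.refl _ _) hh]
    congr 1
    refine integral_congr_ae (Eventually.of_forall fun z => ?_)
    simp only [mulDiv, RCLike.inner_apply, conj_trivial, inner_smul_left]
    ring

end Equations

/-! ### Absolutely continuous functions of time with values in a Hilbert space -/

section Time

theorem absolutelyContinuousOnInterval_of_dist_le {X : Type*} [PseudoMetricSpace X] {f : ℝ → X}
    {g : ℝ → ℝ} {a b C : ℝ} (hg : AbsolutelyContinuousOnInterval g a b)
    (h : ∀ x ∈ uIcc a b, ∀ y ∈ uIcc a b, dist (f x) (f y) ≤ C * dist (g x) (g y)) :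
    AbsolutelyContinuousOnInterval f a b := by
  unfold AbsolutelyContinuousOnInterval at hg ⊢
  refine squeeze_zero' (Eventually.of_forall fun E => Finset.sum_nonneg fun i _ => dist_nonneg) ?_
    (by simpa using hg.const_mul C)
  refine eventually_inf_principal.2 (Eventually.of_forall fun E hE => ?_)
  rw [Finset.mul_sum]
  exact Finset.sum_le_sum fun i hi => h _ (hE.1 i hi).1 _ (hE.1 i hi).2

variable {X : Type*} [NormedAddCommGroup X]

section NormedSpace

variable [NormedSpace ℝ X] {T : ℝ} {f f' g g' : ℝ → X}

theorem HasTimeDeriv.intervalIntegrable (h : HasTimeDeriv T f f') {s t : ℝ} (hs : s ∈ Icc 0 T)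
    (ht : t ∈ Icc 0 T) : IntervalIntegrable f' volume s t := by
  have h0 : IntervalIntegrable f' volume 0 T := by
    rw [intervalIntegrable_iff_integrableOn_Ioo_of_le (hs.1.trans hs.2)]
    exact h.1.integrable (by norm_num)
  refine h0.mono_set ?_
  rw [uIcc_of_le (hs.1.trans hs.2)]
  exact uIcc_subset_Icc hs ht

theorem HasTimeDeriv.sub_eq_integral (h : HasTimeDeriv T f f') {s t : ℝ} (hs : s ∈ Icc 0 T)
    (ht : t ∈ Icc 0 T) : f t - f s = ∫ r in s..t, f' r := by
  have h0 : (0 : ℝ) ∈ Icc 0 T := ⟨le_rfl, hs.1.trans hs.2⟩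
  rw [h.2 t ht, h.2 s hs, ← intervalIntegral.integral_add_adjacent_intervals
    (h.intervalIntegrable h0 hs) (h.intervalIntegrable hs ht)]
  abel

theorem HasTimeDeriv.sub (h : HasTimeDeriv T f f') (h' : HasTimeDeriv T g g') :
    HasTimeDeriv T (fun t => f t - g t) (fun t => f' t - g' t) := by
  refine ⟨h.1.sub h'.1, fun t ht => ?_⟩
  have h0 : (0 : ℝ) ∈ Icc 0 T := ⟨le_rfl, ht.1.trans ht.2⟩
  rw [intervalIntegral.integral_sub (h.intervalIntegrable h0 ht) (h'.intervalIntegrable h0 ht),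
    ← h.sub_eq_integral h0 ht, ← h'.sub_eq_integral h0 ht]
  module

theorem measurePreserving_add_Ioo (T h : ℝ) : MeasurePreserving (fun t => t + h)
    (volume.restrict (Ioo 0 (T - h))) (volume.restrict (Ioo h T)) := by
  have h1 := (measurePreserving_add_right (volume : Measure ℝ) h).restrict_preimage
    (measurableSet_Ioo (a := h) (b := T))
  have h2 : (fun t => t + h) ⁻¹' Ioo h T = Ioo 0 (T - h) := by
    rw [preimage_add_const_Ioo, sub_self]
  rwa [h2] at h1

/-- The increments of an absolutely continuous function over a fixed time step. -/
theorem HasTimeDeriv.increment (h : HasTimeDeriv T f f') {δ : ℝ} (hδ : 0 ≤ δ) :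
    HasTimeDeriv (T - δ) (fun t => f (t + δ) - f t) (fun t => f' (t + δ) - f' t) := by
  have hmem : ∀ {t}, t ∈ Icc 0 (T - δ) → t ∈ Icc 0 T ∧ t + δ ∈ Icc 0 T := by
    intro t ht
    exact ⟨⟨ht.1, by linarith [ht.2]⟩, ⟨by linarith [ht.1], by linarith [ht.2]⟩⟩
  refine ⟨MemLp.sub ?_ ?_, fun t ht => ?_⟩
  · have h1 : MemLp f' 2 (volume.restrict (Ioo δ T)) :=
      h.1.mono_measure (Measure.restrict_mono (Ioo_subset_Ioo_left hδ) le_rfl)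
    exact h1.comp_measurePreserving (measurePreserving_add_Ioo T δ)
  · exact h.1.mono_measure (Measure.restrict_mono (Ioo_subset_Ioo_right (by linarith)) le_rfl)
  · have h0 : (0 : ℝ) ∈ Icc 0 (T - δ) := ⟨le_rfl, ht.1.trans ht.2⟩
    obtain ⟨a1, a2⟩ := hmem h0
    obtain ⟨b1, b2⟩ := hmem ht
    have i1 : IntervalIntegrable (fun s => f' (s + δ)) volume 0 t := by
      simpa using (h.intervalIntegrable a2 b2).comp_add_right δ
    rw [intervalIntegral.integral_sub i1 (h.intervalIntegrable a1 b1),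
      intervalIntegral.integral_comp_add_right, ← h.sub_eq_integral a2 b2,
      ← h.sub_eq_integral a1 b1]
    simp only [zero_add]
    module

theorem HasTimeDeriv.continuousOn (h : HasTimeDeriv T f f') : ContinuousOn f (Icc 0 T) := by
  rcases le_or_gt 0 T with hT | hT
  · have h0 : (0 : ℝ) ∈ Icc 0 T := ⟨le_rfl, hT⟩
    have h1 : IntegrableOn f' (uIcc 0 T) volume :=
      (intervalIntegrable_iff' (by simp)).1 (h.intervalIntegrable h0 ⟨hT, le_rfl⟩)
    have h2 := intervalIntegral.continuousOn_primitive_interval h1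
    rw [uIcc_of_le hT] at h2
    exact (continuousOn_const.add h2).congr fun t ht => h.2 t ht
  · rw [Icc_eq_empty (not_le.2 hT)]
    exact continuousOn_empty _

theorem HasTimeDeriv.exists_bound (h : HasTimeDeriv T f f') : ∃ B, ∀ t ∈ Icc 0 T, ‖f t‖ ≤ B :=
  isCompact_Icc.exists_bound_of_continuousOn h.continuousOn

theorem HasTimeDeriv.ae_hasDerivAt [CompleteSpace X] (h : HasTimeDeriv T f f') :
    ∀ᵐ t ∂(volume.restrict (Ioo 0 T)), HasDerivAt f (f' t) t := by
  rcases le_or_gt 0 T with hT | hT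
  · have h0 : (0 : ℝ) ∈ Icc 0 T := ⟨le_rfl, hT⟩
    rw [ae_restrict_iff' measurableSet_Ioo]
    filter_upwards [(h.intervalIntegrable h0 ⟨hT, le_rfl⟩).ae_hasDerivAt_integral] with t ht htT
    have h1 := ht (by rw [uIcc_of_le hT]; exact Ioo_subset_Icc_self htT) 0 (by simp)
    refine (h1.const_add (f 0)).congr_of_eventuallyEq ?_
    filter_upwards [Ioo_mem_nhds htT.1 htT.2] with s hs
    exact h.2 s (Ioo_subset_Icc_self hs)
  · rw [Ioo_eq_empty (not_lt.2 hT.le)]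
    simp

end NormedSpace

section InnerProductSpace

variable [InnerProductSpace ℝ X] {T : ℝ} {f f' : ℝ → X}

/-- The fundamental theorem of calculus for the square of the norm. It is absolutely continuous,
because its increments are bounded by those of a multiple of the primitive of `‖f'‖`. -/
theorem HasTimeDeriv.norm_sq [CompleteSpace X] (h : HasTimeDeriv T f f') {t : ℝ}
    (ht : t ∈ Icc 0 T) : IntervalIntegrable (fun s => inner ℝ (f s) (f' s)) volume 0 t ∧
      ‖f t‖ ^ 2 = ‖f 0‖ ^ 2 + 2 * ∫ s in (0 : ℝ)..t, inner ℝ (f s) (f' s) := by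
  have h0 : (0 : ℝ) ∈ Icc 0 T := ⟨le_rfl, ht.1.trans ht.2⟩
  obtain ⟨B, hB⟩ := h.exists_bound
  have hi := h.intervalIntegrable h0 ht
  have hsub : uIcc 0 t ⊆ Icc 0 T := uIcc_subset_Icc h0 ht
  have hac : AbsolutelyContinuousOnInterval (fun s => ‖f s‖ ^ 2) 0 t := by
    refine absolutelyContinuousOnInterval_of_dist_le (C := 2 * B)
      (hi.norm.absolutelyContinuousOnInterval_intervalIntegral (c := 0) (by simp))
      fun x hx y hy => ?_
    have hxT := hsub hx
    have hyT := hsub hy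
    have hB0 : 0 ≤ B := (norm_nonneg _).trans (hB _ hxT)
    have e1 : ‖f x - f y‖ ≤ dist (∫ v in (0 : ℝ)..x, ‖f' v‖) (∫ v in (0 : ℝ)..y, ‖f' v‖) := by
      rw [h.sub_eq_integral hyT hxT, Real.dist_eq, intervalIntegral.integral_interval_sub_left
        (h.intervalIntegrable h0 hxT).norm (h.intervalIntegrable h0 hyT).norm]
      exact intervalIntegral.norm_integral_le_abs_integral_norm
    calc dist (‖f x‖ ^ 2) (‖f y‖ ^ 2) = (‖f x‖ + ‖f y‖) * |‖f x‖ - ‖f y‖| := by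
          rw [Real.dist_eq, sq_sub_sq, abs_mul, abs_of_nonneg (by positivity)]
      _ ≤ (2 * B) * ‖f x - f y‖ := by
          refine mul_le_mul (by linarith [hB _ hxT, hB _ hyT]) (abs_norm_sub_norm_le _ _)
            (abs_nonneg _) (by positivity)
      _ ≤ _ := mul_le_mul_of_nonneg_left e1 (by positivity)
  have hd : ∀ᵐ s : ℝ, s ∈ uIoc 0 t →
      deriv (fun s => ‖f s‖ ^ 2) s = 2 * inner ℝ (f s) (f' s) := by
    have h1 := (ae_restrict_iff' measurableSet_Ioo).1 h.ae_hasDerivAt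
    have h3 : ∀ᵐ s : ℝ, s ≠ t := by simp [ae_iff]
    filter_upwards [h1, h3] with s hs hst hmem
    rw [uIoc_of_le ht.1] at hmem
    exact (hs ⟨hmem.1, (lt_of_le_of_ne hmem.2 hst).trans_le ht.2⟩).norm_sq.deriv
  have hint := hac.intervalIntegrable_deriv
  have hint' : IntervalIntegrable (fun s => 2 * inner ℝ (f s) (f' s)) volume 0 t :=
    hint.congr_ae ((ae_restrict_iff' measurableSet_uIoc).2 hd)
  refine ⟨by simpa using hint'.const_mul (1 / 2), ?_⟩
  have h1 := hac.integral_deriv_eq_sub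
  rw [intervalIntegral.integral_congr_ae hd, intervalIntegral.integral_const_mul] at h1
  linarith

variable {Y : Type*} [NormedAddCommGroup Y] [InnerProductSpace ℝ Y] [CompleteSpace X]
  [CompleteSpace Y] {g g' : ℝ → Y}

theorem HasTimeDeriv.energy_eq (h : HasTimeDeriv T f f') (hg : HasTimeDeriv T g g')
    (h0 : ∀ᵐ t ∂(volume.restrict (Ioo 0 T)),
      inner ℝ (f t) (f' t) + inner ℝ (g t) (g' t) = (0 : ℝ)) {t : ℝ} (ht : t ∈ Icc 0 T) :
    ‖f t‖ ^ 2 + ‖g t‖ ^ 2 = ‖f 0‖ ^ 2 + ‖g 0‖ ^ 2 := by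
  obtain ⟨i1, e1⟩ := h.norm_sq ht
  obtain ⟨i2, e2⟩ := hg.norm_sq ht
  have h1 : ∫ s in (0 : ℝ)..t, (inner ℝ (f s) (f' s) + inner ℝ (g s) (g' s)) = (0 : ℝ) := by
    refine (intervalIntegral.integral_congr_ae (g := fun _ => (0 : ℝ)) ?_).trans (by simp)
    have h3 : ∀ᵐ s : ℝ, s ≠ t := by simp [ae_iff]
    filter_upwards [(ae_restrict_iff' measurableSet_Ioo).1 h0, h3] with s hs hst hmem
    rw [uIoc_of_le ht.1] at hmem
    exact hs ⟨hmem.1, (lt_of_le_of_ne hmem.2 hst).trans_le ht.2⟩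
  rw [intervalIntegral.integral_add i1 i2] at h1
  linarith

/-- A skew symmetric relation between two functions and their derivatives is inherited by the
increments. So the norm of the increments is constant in time, and so is its limit, the norm of the
time derivative. -/
theorem HasTimeDeriv.exists_bound_deriv (hT : 0 < T) (h : HasTimeDeriv T f f')
    (hg : HasTimeDeriv T g g') {P : ℝ → Prop} (hP : ∀ᵐ t ∂(volume.restrict (Ioo 0 T)), P t)
    (hskew : ∀ t s, P t → P s → inner ℝ (f t) (f' s) + inner ℝ (g s) (g' t) = (0 : ℝ)) :
    ∃ B, ∀ᵐ t ∂(volume.restrict (Ioo 0 T)), ‖f' t‖ ≤ B ∧ ‖g' t‖ ≤ B := by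
  have hconst : ∀ δ, 0 ≤ δ → ∀ t ∈ Icc 0 (T - δ),
      ‖f (t + δ) - f t‖ ^ 2 + ‖g (t + δ) - g t‖ ^ 2
        = ‖f (0 + δ) - f 0‖ ^ 2 + ‖g (0 + δ) - g 0‖ ^ 2 := by
    intro δ hδ t ht
    refine (h.increment hδ).energy_eq (hg.increment hδ) ?_ ht
    have p1 : ∀ᵐ t ∂(volume.restrict (Ioo 0 (T - δ))), P t :=
      ae_mono (Measure.restrict_mono (Ioo_subset_Ioo_right (by linarith)) le_rfl) hP
    have p2 : ∀ᵐ t ∂(volume.restrict (Ioo δ T)), P t :=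
      ae_mono (Measure.restrict_mono (Ioo_subset_Ioo_left hδ) le_rfl) hP
    filter_upwards [p1, (measurePreserving_add_Ioo T δ).quasiMeasurePreserving.ae p2] with s h1 h2
    simp only [inner_sub_left, inner_sub_right]
    have a1 := hskew s s h1 h1
    have a2 := hskew s (s + δ) h1 h2
    have a3 := hskew (s + δ) s h2 h1
    have a4 := hskew (s + δ) (s + δ) h2 h2
    linarith
  have hlim : ∀ t, HasDerivAt f (f' t) t → HasDerivAt g (g' t) t →
      Tendsto (fun δ => (δ⁻¹) ^ 2 * (‖f (t + δ) - f t‖ ^ 2 + ‖g (t + δ) - g t‖ ^ 2)) (𝓝[>] 0)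
        (𝓝 (‖f' t‖ ^ 2 + ‖g' t‖ ^ 2)) := by
    intro t h1 h2
    have hle : 𝓝[>] (0 : ℝ) ≤ 𝓝[≠] 0 := nhdsWithin_mono _ fun x hx => ne_of_gt hx
    have t1 := (((hasDerivAt_iff_tendsto_slope_zero.1 h1).mono_left hle).norm.pow 2)
    have t2 := (((hasDerivAt_iff_tendsto_slope_zero.1 h2).mono_left hle).norm.pow 2)
    refine (t1.add t2).congr fun δ => ?_
    rw [norm_smul, norm_smul, mul_pow, mul_pow, Real.norm_eq_abs, sq_abs]
    ring
  have hgood := h.ae_hasDerivAt.and hg.ae_hasDerivAt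
  have hne : volume.restrict (Ioo 0 T) ≠ 0 := by
    rw [Ne, Measure.restrict_eq_zero, Real.volume_Ioo]
    simpa using hT
  have : NeBot (ae (volume.restrict (Ioo 0 T))) := ae_neBot.2 hne
  obtain ⟨t₀, ⟨d1, d2⟩, ht₀⟩ := (hgood.and (ae_restrict_mem measurableSet_Ioo)).exists
  refine ⟨√(‖f' t₀‖ ^ 2 + ‖g' t₀‖ ^ 2), ?_⟩
  filter_upwards [hgood, ae_restrict_mem measurableSet_Ioo] with t ⟨e1, e2⟩ ht
  have heq : ‖f' t‖ ^ 2 + ‖g' t‖ ^ 2 = ‖f' t₀‖ ^ 2 + ‖g' t₀‖ ^ 2 := by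
    refine tendsto_nhds_unique (hlim t e1 e2) ((hlim t₀ d1 d2).congr' ?_)
    have hpos : 0 < min (T - t) (T - t₀) := lt_min (sub_pos.2 ht.2) (sub_pos.2 ht₀.2)
    filter_upwards [Ioo_mem_nhdsGT hpos] with δ hδ
    have m1 := hδ.2.le.trans (min_le_left _ _)
    have m2 := hδ.2.le.trans (min_le_right _ _)
    rw [hconst δ hδ.1.le t ⟨ht.1.le, by linarith⟩, hconst δ hδ.1.le t₀ ⟨ht₀.1.le, by linarith⟩]
  rw [← heq]
  exact ⟨Real.le_sqrt_of_sq_le (by linarith [sq_nonneg ‖g' t‖]),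
    Real.le_sqrt_of_sq_le (by linarith [sq_nonneg ‖f' t‖])⟩

/-- If the energy grows at a rate of at most `2 β` times its square root, the square root grows at
most linearly. The estimate is applied at the time where the energy is largest. -/
theorem HasTimeDeriv.sqrt_energy_le (h : HasTimeDeriv T f f') (hg : HasTimeDeriv T g g') {β : ℝ}
    (hβ : 0 ≤ β) (hle : ∀ᵐ t ∂(volume.restrict (Ioo 0 T)),
      inner ℝ (f t) (f' t) + inner ℝ (g t) (g' t) ≤ β * √(‖f t‖ ^ 2 + ‖g t‖ ^ 2)) {t : ℝ}
    (ht : t ∈ Icc 0 T) :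
    √(‖f t‖ ^ 2 + ‖g t‖ ^ 2) ≤ √(‖f 0‖ ^ 2 + ‖g 0‖ ^ 2) + 2 * β * t := by
  have hsub : Icc 0 t ⊆ Icc 0 T := Icc_subset_Icc_right ht.2
  have hc : ContinuousOn (fun s => √(‖f s‖ ^ 2 + ‖g s‖ ^ 2)) (Icc 0 t) :=
    (((h.continuousOn.mono hsub).norm.pow 2).add ((hg.continuousOn.mono hsub).norm.pow 2)).sqrt
  obtain ⟨s, hs, hmax⟩ := isCompact_Icc.exists_isMaxOn ⟨t, ht.1, le_rfl⟩ hc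
  set S := √(‖f s‖ ^ 2 + ‖g s‖ ^ 2) with hS
  set R := √(‖f 0‖ ^ 2 + ‖g 0‖ ^ 2) with hR
  have hS0 : 0 ≤ S := Real.sqrt_nonneg _
  have hR0 : 0 ≤ R := Real.sqrt_nonneg _
  have hRS : R ≤ S := hmax (⟨le_rfl, ht.1⟩ : (0 : ℝ) ∈ Icc 0 t)
  obtain ⟨i1, e1⟩ := h.norm_sq (hsub hs)
  obtain ⟨i2, e2⟩ := hg.norm_sq (hsub hs)
  have e3 : ∫ r in (0 : ℝ)..s, (inner ℝ (f r) (f' r) + inner ℝ (g r) (g' r)) ≤ s * (β * S) := by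
    have h1 : ∫ r in (0 : ℝ)..s, (inner ℝ (f r) (f' r) + inner ℝ (g r) (g' r))
        ≤ ∫ _ in (0 : ℝ)..s, β * S := by
      refine intervalIntegral.integral_mono_ae_restrict hs.1 (i1.add i2)
        intervalIntegrable_const ?_
      rw [EventuallyLE, ← Measure.restrict_congr_set Ioo_ae_eq_Icc]
      have h2 := ae_mono (Measure.restrict_mono (μ := (volume : Measure ℝ))
        (Ioo_subset_Ioo_right (hsub hs).2 : Ioo 0 s ⊆ Ioo 0 T) le_rfl) hle
      filter_upwards [h2, ae_restrict_mem measurableSet_Ioo] with r hr hrs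
      exact hr.trans (mul_le_mul_of_nonneg_left
        (hmax (⟨hrs.1.le, hrs.2.le.trans hs.2⟩ : r ∈ Icc 0 t)) hβ)
    rwa [intervalIntegral.integral_const, sub_zero, smul_eq_mul] at h1
  rw [intervalIntegral.integral_add i1 i2] at e3
  have e4 : S ^ 2 = ‖f s‖ ^ 2 + ‖g s‖ ^ 2 := Real.sq_sqrt (by positivity)
  have e5 : R ^ 2 = ‖f 0‖ ^ 2 + ‖g 0‖ ^ 2 := Real.sq_sqrt (by positivity)
  -- the energy identity at `s` reads `S² ≤ R² + 2 β s S`; one factor `S` is cancelled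
  have e6 : S * S ≤ (R + 2 * β * t) * S := by
    have k1 : R * R ≤ R * S := mul_le_mul_of_nonneg_left hRS hR0
    have k2 : s * (β * S) ≤ t * (β * S) :=
      mul_le_mul_of_nonneg_right hs.2 (mul_nonneg hβ hS0)
    nlinarith
  have e7 : S ≤ R + 2 * β * t := by
    rcases hS0.eq_or_lt with h0 | h0
    · rw [← h0]
      have := mul_nonneg hβ ht.1
      linarith
    · exact le_of_mul_le_mul_right e6 h0
  exact (hmax (⟨ht.1, le_rfl⟩ : t ∈ Icc 0 t)).trans e7

end InnerProductSpace

end Time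

/-! ### Bounds for a solution and for the difference of two solutions -/

section Stability

variable {N : ℕ} {μ : Measure (Param N)} {D : Set Plane}

theorem HasSpatialGrad.unique (hD : IsOpen D) {v : ScalarL2 μ D} {g g' : VectorL2 μ D}
    (h : HasSpatialGrad v g) (h' : HasSpatialGrad v g') : g = g' := by
  refine Lp.ext (ae_eq_prod_of_ae_ae_eq (Lp.aestronglyMeasurable g) (Lp.aestronglyMeasurable g') ?_)
  filter_upwards [h, h'] with y h1 h2
  exact h1.unique hD h2

theorem HasSpatialJacobian.unique (hD : IsOpen D) {w : VectorL2 μ D} {G G' : Fin 2 → VectorL2 μ D}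
    (h : HasSpatialJacobian w G) (h' : HasSpatialJacobian w G') : G = G' := by
  funext i
  refine Lp.ext (ae_eq_prod_of_ae_ae_eq (Lp.aestronglyMeasurable _) (Lp.aestronglyMeasurable _) ?_)
  filter_upwards [h i, h' i] with y h1 h2
  exact h1.unique hD h2

theorem HasSpatialJacobian.sub (hD : IsOpen D) {w w' : VectorL2 μ D} {G G' : Fin 2 → VectorL2 μ D}
    (h : HasSpatialJacobian w G) (h' : HasSpatialJacobian w' G') :
    HasSpatialJacobian (w - w') (fun i => G i - G' i) := by
  intro i
  filter_upwards [h i, h' i, Measure.ae_ae_of_ae_prod (Lp.coeFn_sub w w'),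
    Measure.ae_ae_of_ae_prod (Lp.coeFn_sub (G i) (G' i))] with y h1 h2 h3 h4
  refine (h1.sub h2).congr hD ?_ ?_
  · filter_upwards [h3] with x hx
    rw [hx]
    simp
  · filter_upwards [h4] with x hx
    rw [hx]
    simp

theorem divergence_sub (G G' : Fin 2 → VectorL2 μ D) :
    divergence (fun i => G i - G' i) =ᵐ[prodMeasure μ D]
      fun z => divergence G z - divergence G' z := by
  filter_upwards [ae_all_iff.2 fun i => Lp.coeFn_sub (G i) (G' i)] with z hz
  simp only [divergence, hz, Pi.sub_apply, PiLp.sub_apply, Finset.sum_sub_distrib]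

variable {T : ℝ} {a : Param N × Plane → ℝ} {ga : Param N × Plane → Plane} {amin amax : ℝ}
  {ut F : ℝ → ScalarL2 μ D} {q qt : ℝ → VectorL2 μ D} {G : Fin 2 → ℝ → VectorL2 μ D}

theorem IsCoefficient.ae_ne_zero (hamin : 0 < amin) (ha : IsCoefficient μ D amin amax a ga) :
    ∀ᵐ z ∂(prodMeasure μ D), a z ≠ 0 := by
  filter_upwards [ha.lower] with z hz h0
  rw [h0] at hz
  norm_num at hz
  linarith

theorem SolutionNormLE.nonneg (hT : 0 < T) {M : ℝ} (h : SolutionNormLE μ D T ut q M) : 0 ≤ M := by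
  have : NeBot (ae (volume.restrict (Ioo 0 T))) := ae_neBot.2 (by
    rw [Ne, Measure.restrict_eq_zero, Real.volume_Ioo]
    simpa using hT)
  obtain ⟨t, g, G, -, -, hle⟩ := h.exists
  exact (Real.sqrt_nonneg _).trans hle

variable [IsProbabilityMeasure μ]

/-- The second equation in strong form: `q_t = a ∇u_t`. -/
theorem IsStrongSolution.hasSpatialGrad (hD : IsOpen D) (hamin : 0 < amin) (hamax : amin ≤ amax)
    (ha : IsCoefficient μ D amin amax a ga) (h : IsStrongSolution μ D T a ga ut q F qt G) :
    ∀ᵐ t ∂(volume.restrict (Ioo 0 T)), ∀ g : VectorL2 μ D,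
      (g =ᵐ[prodMeasure μ D] fun z => (a z)⁻¹ • qt t z) → HasSpatialGrad (ut t) g := by
  filter_upwards [h.eq_q] with t ht g hg
  exact hasSpatialGrad_of_forall hD fun w H hw =>
    inner_div_add_integral hD (ha.isMultiplier hD hamin) (ha.isMultiplier_inv hD hamin hamax)
      (ha.ae_ne_zero hamin) ht hg hw

/-- The time derivatives are bounded, because testing the equation for `q_t(t)` with `q(s)` shows
that the time derivative is skew symmetric. The equations convert this to a bound for the space
derivatives. -/
theorem IsStrongSolution.exists_solutionNormLE (hT : 0 < T) (hD : IsOpen D) (hamin : 0 < amin)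
    (hamax : amin ≤ amax) (ha : IsCoefficient μ D amin amax a ga)
    (h : IsStrongSolution μ D T a ga ut q F qt G) : ∃ M, SolutionNormLE μ D T ut q M := by
  have hinv := ha.isMultiplier_inv hD hamin hamax
  obtain ⟨B, hB⟩ := h.deriv_ut.exists_bound_deriv hT h.deriv_q (h.eq_q.and h.jacobian)
    fun t s ht hs => by
      rw [real_inner_comm (qt t), add_comm]
      exact ht.1 (q s) _ hs.2 (F s) (h.eq_ut s)
  obtain ⟨B₁, hB₁⟩ := h.deriv_ut.exists_bound
  obtain ⟨B₂, hB₂⟩ := h.deriv_q.exists_bound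
  set c := (√amin)⁻¹ with hc
  have hc0 : 0 < c := inv_pos.2 (Real.sqrt_pos.2 hamin)
  have hcle : ∀ᵐ z ∂(prodMeasure μ D), ‖(a z)⁻¹‖ ≤ c := by
    filter_upwards [ha.le_norm] with z hz
    rw [norm_inv]
    exact inv_anti₀ (Real.sqrt_pos.2 hamin) hz
  set κ := amax / (2 * √amin) with hκ
  have hκ0 : 0 ≤ κ := div_nonneg (hamin.le.trans hamax) (by positivity)
  refine ⟨√(B₁ ^ 2 + (c * B) ^ 2 + B₂ ^ 2 + (c * B + c * κ * B₂) ^ 2), ?_⟩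
  filter_upwards [hB, h.jacobian, h.hasSpatialGrad hD hamin hamax ha,
    ae_restrict_mem measurableSet_Ioo] with t ⟨hF, hqt⟩ hjac hgrad htT
  have htI := Ioo_subset_Icc_self htT
  have mg : MemLp (fun z => (a z)⁻¹ • qt t z) 2 (prodMeasure μ D) :=
    memLp_smul_of_bound hinv.meas hcle (Lp.memLp _)
  refine ⟨mg.toLp _, fun i => G i t, hgrad _ mg.coeFn_toLp, hjac, Real.sqrt_le_sqrt ?_⟩
  have md := memLp_divergence (μ := μ) (D := D) (fun i => G i t)
  rw [meanSq_eq_norm_sq (ut t) (EventuallyEq.refl _ _),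
    meanSq_eq_norm_sq (mg.toLp _) (EventuallyEq.refl _ _),
    meanSq_eq_norm_sq (q t) (EventuallyEq.refl _ _), meanSq_eq_norm_sq (md.toLp _) md.coeFn_toLp]
  have n1 : ‖mg.toLp _‖ ≤ c * B := by
    refine (Lp.norm_le_mul_norm_of_ae_le_mul (g := qt t) ?_).trans
      (mul_le_mul_of_nonneg_left hqt hc0.le)
    filter_upwards [mg.coeFn_toLp, hcle] with z h1 h2
    rw [h1, norm_smul]
    exact mul_le_mul_of_nonneg_right h2 (norm_nonneg _)
  have mF : MemLp (fun z => (a z)⁻¹ • F t z) 2 (prodMeasure μ D) :=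
    memLp_smul_of_bound hinv.meas hcle (Lp.memLp _)
  have n2 : ‖mF.toLp _‖ ≤ c * B := by
    refine (Lp.norm_le_mul_norm_of_ae_le_mul (g := F t) ?_).trans
      (mul_le_mul_of_nonneg_left hF hc0.le)
    filter_upwards [mF.coeFn_toLp, hcle] with z h1 h2
    rw [h1, norm_smul]
    exact mul_le_mul_of_nonneg_right h2 (norm_nonneg _)
  -- `div q = (u_tt - ∇a · q) / a`
  have n3 : ‖md.toLp _ - mF.toLp _‖ ≤ c * κ * B₂ := by
    refine (Lp.norm_le_mul_norm_of_ae_le_mul (g := q t) ?_).trans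
      (mul_le_mul_of_nonneg_left (hB₂ t htI) (by positivity))
    filter_upwards [Lp.coeFn_sub (md.toLp _) (mF.toLp _), md.coeFn_toLp, mF.coeFn_toLp, hcle,
      ha.norm_grad_le hD hamin, h.eq_ut t, ha.ae_ne_zero hamin] with z h1 h2 h3 h4 h5 h6 h7
    have e : divergence (fun i => G i t) z - (a z)⁻¹ • F t z
        = -((a z)⁻¹ * inner ℝ (ga z) (q t z)) := by
      rw [h6, mulDiv, smul_eq_mul]
      field_simp
      ring
    rw [h1, Pi.sub_apply, h2, h3, e, norm_neg, norm_mul, mul_assoc c]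
    refine mul_le_mul h4 ((norm_inner_le_norm _ _).trans ?_) (norm_nonneg _) hc0.le
    exact mul_le_mul_of_nonneg_right h5 (norm_nonneg _)
  have n4 : ‖md.toLp _‖ ≤ c * B + c * κ * B₂ := by
    calc ‖md.toLp _‖ = ‖mF.toLp _ + (md.toLp _ - mF.toLp _)‖ := by rw [add_sub_cancel]
      _ ≤ _ := (norm_add_le _ _).trans (add_le_add n2 n3)
  have p1 := pow_le_pow_left₀ (norm_nonneg _) (hB₁ t htI) 2
  have p2 := pow_le_pow_left₀ (norm_nonneg _) n1 2
  have p3 := pow_le_pow_left₀ (norm_nonneg _) (hB₂ t htI) 2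
  have p4 := pow_le_pow_left₀ (norm_nonneg _) n4 2
  linarith

/-- Since weak gradients are unique, the bound `M` applies to `∇u_t = q_t / a` and to the divergence
computed from the given Jacobian. -/
theorem IsStrongSolution.norm_le_of_solutionNormLE (hD : IsOpen D) (hamin : 0 < amin)
    (hamax : amin ≤ amax) (ha : IsCoefficient μ D amin amax a ga)
    (h : IsStrongSolution μ D T a ga ut q F qt G) {M : ℝ} (hM : SolutionNormLE μ D T ut q M) :
    ∀ᵐ t ∂(volume.restrict (Ioo 0 T)), ∀ g : VectorL2 μ D,
      (g =ᵐ[prodMeasure μ D] fun z => (a z)⁻¹ • qt t z) → ∀ d : ScalarL2 μ D,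
      d =ᵐ[prodMeasure μ D] divergence (fun i => G i t) → ‖g‖ ≤ M ∧ ‖q t‖ ≤ M ∧ ‖d‖ ≤ M := by
  filter_upwards [hM, h.jacobian, h.hasSpatialGrad hD hamin hamax ha]
    with t ⟨g', G', hg', hG', hle⟩ hjac hgrad g hg d hd
  obtain rfl := (hgrad g hg).unique hD hg'
  rw [← hjac.unique hD hG', meanSq_eq_norm_sq (ut t) (EventuallyEq.refl _ _),
    meanSq_eq_norm_sq g (EventuallyEq.refl _ _),
    meanSq_eq_norm_sq (q t) (EventuallyEq.refl _ _), meanSq_eq_norm_sq d hd] at hle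
  have k1 := sq_nonneg ‖ut t‖
  have k2 := sq_nonneg ‖g‖
  have k3 := sq_nonneg ‖q t‖
  have k4 := sq_nonneg ‖d‖
  exact ⟨(Real.le_sqrt_of_sq_le (by linarith)).trans hle,
    (Real.le_sqrt_of_sq_le (by linarith)).trans hle,
    (Real.le_sqrt_of_sq_le (by linarith)).trans hle⟩

variable {a' : Param N × Plane → ℝ} {ga' : Param N × Plane → Plane} {amin' amax' : ℝ}
  {ut' F' : ℝ → ScalarL2 μ D} {q' qt' : ℝ → VectorL2 μ D} {G' : Fin 2 → ℝ → VectorL2 μ D}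

/-- The rate of change of the energy of the difference. The difference solves the system with the
coefficient `a'` up to the residuals `(a - a') div q + ∇(a - a') · q` and `(a - a') ∇u_t`, and the
spatial operator of that system is skew symmetric. -/
theorem IsStrongSolution.inner_sub_le (hD : IsOpen D) (hamin : 0 < amin) (hamax : amin ≤ amax)
    (ha : IsCoefficient μ D amin amax a ga) (h : IsStrongSolution μ D T a ga ut q F qt G)
    (hamin' : 0 < amin') (ha' : IsCoefficient μ D amin' amax' a' ga')
    (h' : IsStrongSolution μ D T a' ga' ut' q' F' qt' G') {M δ : ℝ} (hδ : 0 ≤ δ)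
    (hM : SolutionNormLE μ D T ut q M)
    (hsub : ∀ᵐ z ∂(prodMeasure μ D), ‖a z - a' z‖ ≤ δ ∧ ‖ga z - ga' z‖ ≤ δ) :
    ∀ᵐ t ∂(volume.restrict (Ioo 0 T)),
      inner ℝ (ut t - ut' t) (F t - F' t) + inner ℝ (q t - q' t) (qt t - qt' t)
        ≤ 3 * δ * M * √(‖ut t - ut' t‖ ^ 2 + ‖q t - q' t‖ ^ 2) := by
  have hm := ha.isMultiplier hD hamin
  have hm' := ha'.isMultiplier hD hamin'
  have hinv := ha.isMultiplier_inv hD hamin hamax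
  filter_upwards [h.norm_le_of_solutionNormLE hD hamin hamax ha hM, h.eq_q, h'.eq_q, h.jacobian,
    h'.jacobian] with t hle heq heq' hjac hjac'
  set e := ut t - ut' t with he
  set r := q t - q' t with hr
  have hJ := hjac.sub hD hjac'
  rw [← hr] at hJ
  set J : Fin 2 → VectorL2 μ D := fun i => G i t - G' i t with hJdef
  -- the divergence of `a' r`
  have mA := hm'.memLp_mulDiv r J
  set A := mA.toLp _ with hA
  have hAeq : A =ᵐ[prodMeasure μ D] mulDiv a' ga' r J := mA.coeFn_toLp
  -- the gradient of `u_t`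
  have mg : MemLp (fun z => (a z)⁻¹ • qt t z) 2 (prodMeasure μ D) :=
    memLp_smul_of_bound hinv.meas hinv.le (Lp.memLp _)
  set g := mg.toLp _ with hgdef
  have hg : g =ᵐ[prodMeasure μ D] fun z => (a z)⁻¹ • qt t z := mg.coeFn_toLp
  have md := memLp_divergence (μ := μ) (D := D) (fun i => G i t)
  set d := md.toLp _ with hddef
  have hd : d =ᵐ[prodMeasure μ D] divergence (fun i => G i t) := md.coeFn_toLp
  obtain ⟨ng, nq, nd⟩ := hle g hg d hd
  have mh : MemLp (fun z => (a z - a' z) • d z) 2 (prodMeasure μ D) :=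
    memLp_smul_of_bound (ha.meas.sub ha'.meas) (hsub.mono fun z hz => hz.1) (Lp.memLp _)
  -- the residual `h₁ + h₂` of the first equation: `h₁ = (a - a') div q`, `h₂ = ∇(a - a') · q`
  set h₁ := mh.toLp _ with hh₁
  set h₂ := F t - F' t - A - h₁ with hh₂
  have mk : MemLp (fun z => a' z • g z) 2 (prodMeasure μ D) :=
    memLp_smul_of_bound hm'.meas hm'.le (Lp.memLp _)
  -- the residual `k = (a - a') ∇u_t` of the second equation
  set b := mk.toLp _ with hb
  set k := qt t - b with hk
  have n1 : ‖h₁‖ ≤ δ * M := by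
    refine (Lp.norm_le_mul_norm_of_ae_le_mul (g := d) ?_).trans (mul_le_mul_of_nonneg_left nd hδ)
    filter_upwards [mh.coeFn_toLp, hsub] with z e1 e2
    rw [hh₁, e1, norm_smul]
    exact mul_le_mul_of_nonneg_right e2.1 (norm_nonneg _)
  have n2 : ‖h₂‖ ≤ δ * M := by
    refine (Lp.norm_le_mul_norm_of_ae_le_mul (g := q t) ?_).trans (mul_le_mul_of_nonneg_left nq hδ)
    filter_upwards [mh.coeFn_toLp, hsub, Lp.coeFn_sub (F t - F' t - A) h₁,
      Lp.coeFn_sub (F t - F' t) A, Lp.coeFn_sub (F t) (F' t), hAeq, h.eq_ut t, h'.eq_ut t, hd,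
      Lp.coeFn_sub (q t) (q' t), divergence_sub (fun i => G i t) (fun i => G' i t)]
      with z e1 e2 e3 e4 e5 e6 e7 e8 e9 e10 e11
    have key : h₂ z = inner ℝ (ga z - ga' z) (q t z) := by
      rw [hh₂, e3, Pi.sub_apply, e4, Pi.sub_apply, e5, Pi.sub_apply, hh₁, e1, e6, e7, e8, e9,
        mulDiv, mulDiv, mulDiv, hJdef, e11, hr, e10, Pi.sub_apply, inner_sub_left, inner_sub_right,
        smul_eq_mul]
      ring
    rw [key]
    exact (norm_inner_le_norm _ _).trans (mul_le_mul_of_nonneg_right e2.2 (norm_nonneg _))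
  have n3 : ‖k‖ ≤ δ * M := by
    refine (Lp.norm_le_mul_norm_of_ae_le_mul (g := g) ?_).trans (mul_le_mul_of_nonneg_left ng hδ)
    filter_upwards [mk.coeFn_toLp, hsub, Lp.coeFn_sub (qt t) b, hg, ha.ae_ne_zero hamin]
      with z e1 e2 e3 e4 e5
    have e6 : qt t z = a z • g z := by rw [e4, smul_inv_smul₀ e5]
    rw [hk, e3, Pi.sub_apply, hb, e1, e6, ← sub_smul, norm_smul]
    exact mul_le_mul_of_nonneg_right e2.1 (norm_nonneg _)
  -- both equations for `q_t` are tested with `r`, the one with coefficient `a` in the form in which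
  -- `a` has been divided out and `a'` multiplied in
  have i1 : inner ℝ (qt' t) r + inner ℝ (ut' t) A = (0 : ℝ) := heq' r J hJ A hAeq
  have i2 : inner ℝ b r + inner ℝ (ut t) A = (0 : ℝ) := by
    obtain ⟨w, H, hwH, hw, hH⟩ := hm'.exists_mul hD hJ
    rw [← inner_div_add_integral hD hm hinv (ha.ae_ne_zero hamin) heq hg hwH,
      inner_eq_integral mk.coeFn_toLp (EventuallyEq.refl _ _),
      inner_eq_integral (EventuallyEq.refl _ _) hw,
      inner_eq_integral (EventuallyEq.refl _ _) (hAeq.trans hH.symm)]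
    congr 1
    · simp only [inner_smul_left, inner_smul_right, conj_trivial]
    · simp [mul_comm]
  -- the terms with `A` cancel: this is the skew symmetry of the spatial operator
  have hsum : inner ℝ e (F t - F' t) + inner ℝ r (qt t - qt' t)
      = inner ℝ e h₁ + inner ℝ e h₂ + inner ℝ k r := by
    have e1 : F t - F' t = h₁ + h₂ + A := by rw [hh₂]; abel
    have e2 : qt t = k + b := by rw [hk]; abel
    have e3 : inner ℝ e A = inner ℝ (ut t) A - inner ℝ (ut' t) A := by rw [he, inner_sub_left]
    rw [e1, e2, inner_add_right, inner_add_right, e3, real_inner_comm (k + b - qt' t) r,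
      inner_sub_left (k + b), inner_add_left k]
    linarith
  set S := √(‖e‖ ^ 2 + ‖r‖ ^ 2)
  have s1 : ‖e‖ ≤ S := Real.le_sqrt_of_sq_le (by linarith [sq_nonneg ‖r‖])
  have s2 : ‖r‖ ≤ S := Real.le_sqrt_of_sq_le (by linarith [sq_nonneg ‖e‖])
  have hS : 0 ≤ S := Real.sqrt_nonneg _
  have j1 : inner ℝ e h₁ ≤ S * (δ * M) :=
    (real_inner_le_norm _ _).trans (mul_le_mul s1 n1 (norm_nonneg _) hS)
  have j2 : inner ℝ e h₂ ≤ S * (δ * M) :=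
    (real_inner_le_norm _ _).trans (mul_le_mul s1 n2 (norm_nonneg _) hS)
  have j3 : inner ℝ k r ≤ δ * M * S :=
    (real_inner_le_norm _ _).trans
      (mul_le_mul n3 s2 (norm_nonneg _) ((norm_nonneg _).trans n3))
  rw [hsum]
  linarith

end Stability

end RandomWave

end

theorem mainTheorem1 (amin amax amin' amax' : ℝ)
    (hamin : 0 < amin) (hamax : amin ≤ amax) (hamin' : 0 < amin') (hamax' : amin' ≤ amax') :
    ∃ K : ℝ, 0 < K ∧
      ∀ (N : ℕ) (μ : Measure (RandomWave.Param N)) (_ : IsProbabilityMeasure μ)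
        (D : Set RandomWave.Plane) (_ : IsOpen D) (T : ℝ) (_ : 0 < T)
        (a : RandomWave.Param N × RandomWave.Plane → ℝ)
        (ga : RandomWave.Param N × RandomWave.Plane → RandomWave.Plane)
        (u ut : ℝ → RandomWave.ScalarL2 μ D) (q : ℝ → RandomWave.VectorL2 μ D),
        RandomWave.IsCoefficient μ D amin amax a ga →
        RandomWave.IsWeakSolution μ D T a ga u ut q →
        (∃ M : ℝ, RandomWave.SolutionNormLE μ D T ut q M) ∧
        ∀ M : ℝ, RandomWave.SolutionNormLE μ D T ut q M →
          ∀ (C₀ ε : ℝ) (_ : 0 < ε)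
            (a' : RandomWave.Param N × RandomWave.Plane → ℝ)
            (ga' : RandomWave.Param N × RandomWave.Plane → RandomWave.Plane)
            (u' ut' : ℝ → RandomWave.ScalarL2 μ D) (q' : ℝ → RandomWave.VectorL2 μ D),
            RandomWave.IsCoefficient μ D amin' amax' a' ga' →
            RandomWave.IsWeakSolution μ D T a' ga' u' ut' q' →
            (∀ᵐ z ∂(RandomWave.prodMeasure μ D), 0 < a z * a' z) →
            RandomWave.LinftyW1inftyNormLE μ D (fun z => a z ^ 2 - a' z ^ 2) ε →
            √(RandomWave.meanSq μ D (ut 0 - ut' 0 : RandomWave.ScalarL2 μ D)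
              + RandomWave.meanSq μ D (q 0 - q' 0 : RandomWave.VectorL2 μ D)) ≤ C₀ * ε →
            ∀ t ∈ Icc 0 T,
              √(RandomWave.meanSq μ D (ut t - ut' t : RandomWave.ScalarL2 μ D))
                + √(RandomWave.meanSq μ D (q t - q' t : RandomWave.VectorL2 μ D))
                ≤ K * (C₀ + M) * (t + 1) * ε := by
  have hc : 0 < RandomWave.coeffConst amin amin' amax' := RandomWave.coeffConst_pos hamin
  -- the energy of the difference grows at a rate of at most `6 c ε M` times its square root, and
  -- `‖e‖ + ‖r‖` is at most twice the square root of the energy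
  refine ⟨2 + 12 * RandomWave.coeffConst amin amin' amax', by positivity, ?_⟩
  intro N μ _ D hD T hT a ga u ut q ha hsol
  obtain ⟨F, qt, G, hs⟩ := hsol.exists_strong hD (ha.isMultiplier hD hamin)
  refine ⟨hs.exists_solutionNormLE hT hD hamin hamax ha, ?_⟩
  intro M hM C₀ ε hε a' ga' u' ut' q' ha' hsol' hpos hle h0 t ht
  obtain ⟨F', qt', G', hs'⟩ := hsol'.exists_strong hD (ha'.isMultiplier hD hamin')
  set c := RandomWave.coeffConst amin amin' amax' with hcdef
  have hM0 : 0 ≤ M := hM.nonneg hT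
  have hC0 : 0 ≤ C₀ := nonneg_of_mul_nonneg_left ((Real.sqrt_nonneg _).trans h0) hε
  rw [RandomWave.meanSq_eq_norm_sq _ (EventuallyEq.refl _ _),
    RandomWave.meanSq_eq_norm_sq _ (EventuallyEq.refl _ _)] at h0
  rw [RandomWave.meanSq_eq_norm_sq _ (EventuallyEq.refl _ _),
    RandomWave.meanSq_eq_norm_sq _ (EventuallyEq.refl _ _), Real.sqrt_sq (norm_nonneg _),
    Real.sqrt_sq (norm_nonneg _)]
  have hcε : 0 ≤ c * ε := by positivity
  have hrate := hs.inner_sub_le hD hamin hamax ha hamin' ha' hs' hcε hM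
    (ha.norm_sub_le hD hamin hamin' ha' hpos hle)
  have hE := (hs.deriv_ut.sub hs'.deriv_ut).sqrt_energy_le (hs.deriv_q.sub hs'.deriv_q)
    (by positivity) hrate ht
  have s1 : ‖ut t - ut' t‖ ≤ √(‖ut t - ut' t‖ ^ 2 + ‖q t - q' t‖ ^ 2) :=
    Real.le_sqrt_of_sq_le (by linarith [sq_nonneg ‖q t - q' t‖])
  have s2 : ‖q t - q' t‖ ≤ √(‖ut t - ut' t‖ ^ 2 + ‖q t - q' t‖ ^ 2) :=
    Real.le_sqrt_of_sq_le (by linarith [sq_nonneg ‖ut t - ut' t‖])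
  calc ‖ut t - ut' t‖ + ‖q t - q' t‖ ≤ 2 * (C₀ * ε + 2 * (3 * (c * ε) * M) * t) := by linarith
    _ = (2 * C₀ + 12 * c * M * t) * ε := by ring
    _ ≤ ((2 + 12 * c) * (C₀ + M) * (t + 1)) * ε := by
        refine mul_le_mul_of_nonneg_right ?_ hε.le
        have ht0 := ht.1
        have k1 : 0 ≤ c * C₀ := by positivity
        have k2 : 0 ≤ c * M := by positivity
        have k3 : 0 ≤ C₀ * t := by positivity
        have k4 : 0 ≤ M * t := by positivity
        have k5 : 0 ≤ c * C₀ * t := by positivity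
        linarith
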